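/- **Setting.** Let $\Delta$ be a finite tree without vertices of valency $2$, and let $w'$ be a distinguished leaf (a leaf is a vertex of valency $1$, a node is a vertex of valency $\delta_v\ge 3$). For each node $v$ and each edge $e$ at $v$ pointing away from $w'$ let a positive integer weight $d_{ve}$ be given (weights in the direction of $w'$ play no role). For distinct vertices $v,w$ let the linking number $\ell_{vw}$ be the product of all weights adjacent to, but not on, the path from $v$ to $w$, and let $\ell'_{vw}$ be the same product without the weights around $v$ and around $w$. (Only such products that do not involve weights in the direction of $w'$ are used.) For an edge $e$ at a node $v$ let $\Delta_{ve}$ be the part of $\Delta$ cut off from $v$ by $e$. Assume that $(\Delta,w')$ satisfies the semigroup condition: for each node $v$ and edge $e$ at $v$ pointing away from $w'$, $d_{ve}$ is a combination with non-negative integer coefficients of the numbers $\ell'_{vw}$, $w$ a leaf in $\Delta_{ve}$. Associate a variable $z_w$ to each leaf $w\ne w'$. For each such $v,e$ choose an admissible monomial $M_{ve}=\prod_{w} z_w^{\alpha_{vw}}$, the product over the leaves $w$ in $\Delta_{ve}$, with integers $\alpha_{vw}\ge 0$ and $d_{ve}=\sum_w\alpha_{vw}\ell'_{vw}$. For each node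 $v$ let $(a_{vie})$ be a complex $(\delta_v-2)\times(\delta_v-1)$ matrix (with $e$ running over the edges at $v$ pointing away from $w'$) all of whose maximal minors are nonzero. The splice diagram curve $C=C(\Delta,w')$ is the subscheme of the affine space with coordinates $z_w$, $w\ne w'$, defined by $$\sum_{e}a_{vie}M_{ve}=0,\qquad v\text{ a node},\quad i=1,\dots,\delta_v-2 .$$ **Theorem.** 1. At a point of $C$ for which one coordinate is $0$, all coordinates are $0$. 2. Except at the origin, $C$ is a smooth curve. 3. The number of irreducible components of $C$ is the greatest common divisor of the numbers $\ell_{w'w}$, $w\ne w'$ a leaf. 4. $C$ is a reduced complete intersection curve (it has pure dimension one, and the number of defining equations is one less than the number of variables), and every irreducible component is isomorphic to a monomial curve, i.e. to $\operatorname{Spec}\mathbb C[t^{n_1},\dots,t^{n_k}]$ for some positive integers $n_1,\dots,n_k$ with $\gcd(n_1,\dots,n_k)=1$. 5. For each leaf $w\ne w'$ let $\alpha_w\ge 0$ be an integer, not all equal to $0$. Then for every $b\in\mathbb C$ with $b\neq 0$ the intersection $C\cap\{\prod_w z_w^{\alpha_w}=b\}$ is everywhere transverse and consists of exactly $\sum_w\alpha_w\ell_{w'w}$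 points. -/

import Mathlib

open MvPolynomial

noncomputable section

/-- A pair `(Δ, w')`: a finite tree without vertices of valency `2`, with a distinguished leaf
`root = w'`, and for every node `v` and every edge `vu` at `v` that points away from `w'` a
positive integer weight `weight v u`, thought of as sitting on the edge at its end `v`.
All other values of `weight` (weights towards the root, pairs that are not edges, weights at
leaves) are irrelevant: nothing below looks at them. -/
structure RootedSpliceDiagram (V : Type*) [Fintype V] where
  graph : SimpleGraph V
  isTree : graph.IsTree
  valency_ne_two : ∀ v, (graph.neighborSet v).ncard ≠ 2
  root : V
  root_leaf : (graph.neighborSet root).ncard = 1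
  weight : V → V → ℕ
  weight_pos : ∀ v u, 3 ≤ (graph.neighborSet v).ncard → graph.Adj v u →
    (∀ p : graph.Walk v root, p.IsPath → s(v, u) ∉ p.edges) → 0 < weight v u

namespace RootedSpliceDiagram

variable {V : Type*} [Fintype V] (D : RootedSpliceDiagram V)

/-- The number of edges at `v`. -/
def valency (v : V) : ℕ := (D.graph.neighborSet v).ncard

/-- The unique path from `v` to `w` in the tree. -/
def path (v w : V) : D.graph.Walk v w := (D.isTree.existsUnique_path v w).choose

/-- The product of all edge weights at the vertex `x` that are adjacent to, but not on, the path
from `v` to `w`. -/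
def offPathWeight (v w x : V) : ℕ :=
  open Classical in
  ∏ u : V with D.graph.Adj x u ∧ s(x, u) ∉ (D.path v w).edges, D.weight x u

/-- The linking number `ℓ_{vw}` of two distinct vertices: the product of all the weights adjacent
to, but not on, the path from `v` to `w`. -/
def linking (v w : V) : ℕ :=
  open Classical in
  ∏ x : V with x ∈ (D.path v w).support, D.offPathWeight v w x

/-- The reduced linking number `ℓ'_{vw}`: as `ℓ_{vw}`, but without the weights around
`v` and `w`. -/
def linking' (v w : V) : ℕ :=
  open Classical in
  ∏ x : V with x ∈ (D.path v w).support ∧ x ≠ v ∧ x ≠ w, D.offPathWeight v w x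

/-- The leaves `w ≠ w'`; they index the variables `z_w`. -/
abbrev Var : Type _ := {w : V // D.valency w = 1 ∧ w ≠ D.root}

/-- The nodes: vertices of valency at least `3`. -/
abbrev Node : Type _ := {v : V // 3 ≤ D.valency v}

/-- The edges at the vertex `v` that point away from `w'`, given by their other end `u`. -/
abbrev OutEdge (v : V) : Type _ :=
  {u : V // D.graph.Adj v u ∧ s(v, u) ∉ (D.path v D.root).edges}

instance : Fintype D.Var := Fintype.ofFinite _
instance : Fintype D.Node := Fintype.ofFinite _
instance (v : V) : Fintype (D.OutEdge v) := Fintype.ofFinite _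

/-- `z_w^m` over the variables, with exponent vector `m`, is an admissible monomial for the edge
`e` at the node `v`: it involves only leaves of `Δ_{ve}` (the leaves `w` such that the path from
`v` to `w` starts with `e`), and `d_{ve} = ∑_w m_w ℓ'_{vw}`. -/
def IsAdmissible (v : V) (e : D.OutEdge v) (m : D.Var →₀ ℕ) : Prop :=
  (∀ w, m w ≠ 0 → s(v, e.1) ∈ (D.path v w.1).edges) ∧
    D.weight v e.1 = ∑ w, m w * D.linking' v w.1

/-- The choices that define a splice diagram curve `C(Δ, w')`: an admissible monomial for each
node and each edge at it that points away from `w'` (such a choice exists exactly if `(Δ, w')`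
satisfies the semigroup condition), and for each node `v` of valency `δ` a
`(δ - 2) × (δ - 1)` matrix of complex coefficients all of whose maximal minors are nonzero. -/
structure CurveData where
  exponent : ∀ v : D.Node, D.OutEdge v.1 → D.Var →₀ ℕ
  admissible : ∀ v e, D.IsAdmissible v.1 e (exponent v e)
  coeff : ∀ v : D.Node, Matrix (Fin (D.valency v.1 - 2)) (D.OutEdge v.1) ℂ
  minor_ne_zero : ∀ (v : D.Node) (c : Fin (D.valency v.1 - 2) → D.OutEdge v.1),
    Function.Injective c → ((coeff v).submatrix id c).det ≠ 0

variable {D}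

/-- The equations of the curve: `∑_e a_{vie} M_{ve}`, for `v` a node and `i = 1, …, δ_v - 2`. -/
def CurveData.equation (C : D.CurveData) (j : Σ v : D.Node, Fin (D.valency v.1 - 2)) :
    MvPolynomial D.Var ℂ :=
  ∑ e : D.OutEdge j.1.1, MvPolynomial.C (C.coeff j.1 j.2 e) * monomial (C.exponent j.1 e) 1

/-- The ideal of the curve as a subscheme of affine space. -/
def CurveData.ideal (C : D.CurveData) : Ideal (MvPolynomial D.Var ℂ) :=
  Ideal.span (Set.range C.equation)

/-- The affine coordinate ring of the scheme `C`. -/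
abbrev CurveData.coordRing (C : D.CurveData) : Type _ := MvPolynomial D.Var ℂ ⧸ C.ideal

end RootedSpliceDiagram

section AffineSchemes

variable {σ : Type*}

/-- The local ring at the point `p` of the closed subscheme of affine space defined by `I`
(the zero ring if `p` does not lie on it). -/
abbrev LocalRingAt (I : Ideal (MvPolynomial σ ℂ)) (p : σ → ℂ) : Type _ :=
  Localization.AtPrime (vanishingIdeal ℂ {p} : Ideal (MvPolynomial σ ℂ)) ⧸
    I.map (algebraMap _ (Localization.AtPrime (vanishingIdeal ℂ {p} : Ideal (MvPolynomial σ ℂ))))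

/-- `p` is a smooth point of the subscheme defined by `I`. (A zero ring is not local, so `p` lies
on the subscheme. Over `ℂ`, smooth and regular are the same.) -/
def IsSmoothPoint (I : Ideal (MvPolynomial σ ℂ)) (p : σ → ℂ) : Prop :=
  IsRegularLocalRing (LocalRingAt I p)

/-- The tangent space at `p` of the subscheme defined by `I`, as a subspace of `ℂ^σ`. -/
def tangentSpaceAt [Fintype σ] (I : Ideal (MvPolynomial σ ℂ)) (p : σ → ℂ) :
    Submodule ℂ (σ → ℂ) where
  carrier := {v | ∀ f ∈ I, ∑ i, eval p (pderiv i f) * v i = 0}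
  zero_mem' := by intro f _; simp
  add_mem' := by
    intro u v hu hv f hf
    simp only [Pi.add_apply, mul_add, Finset.sum_add_distrib, hu f hf, hv f hf, add_zero]
  smul_mem' := by
    intro c v hv f hf
    have h : ∀ i, eval p (pderiv i f) * (c • v) i = c * (eval p (pderiv i f) * v i) := by
      intro i; simp only [Pi.smul_apply, smul_eq_mul]; ring
    simp only [h, ← Finset.mul_sum, hv f hf, mul_zero]

/-- The subschemes defined by `I` and `J` meet transversally at `p`: both are smooth at `p`, and
their tangent spaces there span the tangent space of the ambient space. -/
def MeetTransversallyAt [Fintype σ] (I J : Ideal (MvPolynomial σ ℂ)) (p : σ → ℂ) : Prop :=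
  IsSmoothPoint I p ∧ IsSmoothPoint J p ∧ tangentSpaceAt I p ⊔ tangentSpaceAt J p = ⊤

/-- The polynomials `f j` cut out a complete intersection curve: every irreducible component of
`Spec ℂ[z]/(f)`, and the scheme itself, has dimension one, and the number of equations
is the codimension. -/
def IsCompleteIntersectionCurve [Fintype σ] {ι : Type*} [Fintype ι]
    (f : ι → MvPolynomial σ ℂ) : Prop :=
  Fintype.card ι + 1 = Fintype.card σ ∧
  ringKrullDim (MvPolynomial σ ℂ ⧸ Ideal.span (Set.range f)) = 1 ∧
  ∀ Z ∈ irreducibleComponents (PrimeSpectrum (MvPolynomial σ ℂ ⧸ Ideal.span (Set.range f))),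
    ringKrullDim ((MvPolynomial σ ℂ ⧸ Ideal.span (Set.range f)) ⧸
      PrimeSpectrum.vanishingIdeal Z) = 1

/-- `A` is the coordinate ring of a monomial curve `t ↦ (t^{n_1}, …, t^{n_k})` with positive
exponents of greatest common divisor one, that is, `A ≅ ℂ[t^{n_1}, …, t^{n_k}]`. -/
def IsMonomialCurveRing (A : Type*) [CommRing A] [Algebra ℂ A] : Prop :=
  ∃ s : Finset ℕ, (∀ n ∈ s, 0 < n) ∧ s.gcd id = 1 ∧
    Nonempty (A ≃ₐ[ℂ] Algebra.adjoin ℂ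
      {q : Polynomial ℂ | ∃ n ∈ s, q = Polynomial.X ^ n})

end AffineSchemes

end

/-! The proof compares an upper and a lower bound. Write ℓ_w for the linking number of w' and w, and
`I` for the ideal of C. Since the maximal minors do not vanish, the equations at a node say exactly
that its admissible monomials are proportional to fixed nonzero numbers. Modulo `I` these monomials
are therefore interchangeable up to constants. They also have equal degree when z_w has weight ℓ_w,
so ℂˣ acts on C. Both bounds follow the recursion `linkingFrom_outEdge` for linking numbers, from
the leaves towards the root.

Points (`ncard_torusPoints`): the slice z_w = b of the torus part of C has exactly ℓ_w points. A
solution beyond a node v is a solution beyond the edge towards w, together with solutions beyond the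
other edges e with prescribed values of M_ve. By the semigroup condition M_ve has weight d_ve under
the action beyond e, so there are d_ve such solutions (`ncard_slice`).

Monomials (`generatedBy_single`): modulo `I` and constants, every monomial is a power of z_w times
one of at most ℓ_w monomials. This is division with remainder in each subtree, carried across a node
by trading admissible monomials.

The bounds meet. The points of a slice are distinct characters of the monoid of monomials, so
evaluating the generators at them gives an invertible matrix, and a polynomial that vanishes on the
torus part lies in `I` (`mem_of_eval_eq_zero`). Hence `I` is radical.

`IsTorusCurve` collects what the rest needs. Put g = gcd ℓ_w, n = ℓ/g and choose u with ∑ u_w n_w =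
1. The monomial z^u is a coordinate on each ℂˣ-orbit, so the orbits correspond to the g points with
z^u = 1. Their closures t ↦ (e_w t^(n_w)) are the components, and z^u - t is a local parameter at
the point with parameter t. On an orbit ∏ z_w^(α_w) - b becomes c t^N - b, whose derivative gives
transversality; the number of intersection points comes from `ncard_slice` again. -/

noncomputable section

namespace RootedSpliceDiagram

variable {V : Type*} [Fintype V] (D : RootedSpliceDiagram V)

/-! ### Paths in the tree, ordered from the root outwards. -/

section Paths

open SimpleGraph

lemma path_isPath (v w : V) : (D.path v w).IsPath :=
  (D.isTree.existsUnique_path v w).choose_spec.1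

variable {D} in
lemma eq_path {v w : V} {p : D.graph.Walk v w} (hp : p.IsPath) : p = D.path v w :=
  (D.isTree.existsUnique_path v w).unique hp (D.path_isPath v w)

lemma path_self (v : V) : D.path v v = .nil := (eq_path Walk.IsPath.nil).symm

lemma reverse_path (v w : V) : (D.path v w).reverse = D.path w v :=
  eq_path (D.path_isPath v w).reverse

lemma mem_edges_path_comm {v w : V} {e : Sym2 V} :
    e ∈ (D.path v w).edges ↔ e ∈ (D.path w v).edges := by
  rw [← D.reverse_path w v, Walk.edges_reverse, List.mem_reverse]

lemma path_eq_append {a v x : V} (h : v ∈ (D.path a x).support) :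
    D.path a x = (D.path a v).append (D.path v x) := by
  classical
  conv_lhs => rw [← Walk.take_spec _ h]
  rw [eq_path ((D.path_isPath a x).takeUntil h), eq_path ((D.path_isPath a x).dropUntil h)]

/-- The vertex `u` lies on the path from the root to `x`. -/
def Below (u x : V) : Prop := u ∈ (D.path D.root x).support

variable {D}

lemma Below.refl (x : V) : D.Below x x := Walk.end_mem_support _

lemma Below.root (x : V) : D.Below D.root x := Walk.start_mem_support _

lemma Below.path_eq {u x : V} (h : D.Below u x) :
    D.path D.root x = (D.path D.root u).append (D.path u x) := D.path_eq_append h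

lemma Below.trans {u x w : V} (h : D.Below u x) (h' : D.Below x w) : D.Below u w := by
  rw [Below, h'.path_eq, Walk.mem_support_append_iff]
  exact Or.inl h

lemma Below.mem_support_iff {u w : V} (h : D.Below u w) (x : V) :
    x ∈ (D.path u w).support ↔ D.Below u x ∧ D.Below x w := by
  constructor
  · intro hx
    have hxw : D.Below x w := by
      rw [Below, h.path_eq, Walk.mem_support_append_iff]; exact Or.inr hx
    refine ⟨?_, hxw⟩
    have h1 := h.path_eq
    rw [D.path_eq_append hx, Walk.append_assoc] at h1
    have hp : ((D.path D.root u).append (D.path u x)).IsPath :=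
      Walk.IsPath.of_append_left (h1 ▸ D.path_isPath D.root w)
    rw [Below, ← eq_path hp, Walk.mem_support_append_iff]
    exact Or.inl (Walk.end_mem_support _)
  · rintro ⟨hux, hxw⟩
    have h1 := hxw.path_eq
    rw [hux.path_eq, ← Walk.append_assoc] at h1
    have hp : ((D.path u x).append (D.path x w)).IsPath :=
      Walk.IsPath.of_append_right (h1 ▸ D.path_isPath D.root w)
    rw [← eq_path hp, Walk.mem_support_append_iff]
    exact Or.inl (Walk.end_mem_support _)

lemma Below.mem_edges_iff {v w x : V} (h : D.Below v w) (hx : D.Below v x) (hxw : D.Below x w)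
    (hne : x ≠ v) (y : V) :
    s(x, y) ∈ (D.path D.root w).edges ↔ s(x, y) ∈ (D.path v w).edges := by
  have hp := D.path_isPath D.root w
  rw [h.path_eq] at hp ⊢
  rw [Walk.edges_append, List.mem_append, or_iff_right]
  intro hs
  exact hp.ne_of_mem_support_of_append hne (Walk.fst_mem_support_of_mem_edges _ hs)
    ((h.mem_support_iff x).2 ⟨hx, hxw⟩) rfl

lemma OutEdge.notMem_support {v : V} (e : D.OutEdge v) : e.1 ∉ (D.path D.root v).support := by
  intro h
  have h1 := D.path_eq_append h
  have h2 : D.path e.1 v = Walk.cons e.2.1.symm .nil :=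
    (eq_path (by simpa using e.2.1.ne')).symm
  apply e.2.2
  rw [D.mem_edges_path_comm, h1, Walk.edges_append, h2]
  simp [Sym2.eq_swap]

lemma OutEdge.path_root_eq {v : V} (e : D.OutEdge v) :
    D.path D.root e.1 = (D.path D.root v).concat e.2.1 :=
  (eq_path ((D.path_isPath _ _).concat e.notMem_support e.2.1)).symm

lemma OutEdge.below {v : V} (e : D.OutEdge v) : D.Below v e.1 := by
  rw [Below, e.path_root_eq]; simp

lemma OutEdge.length_path {v : V} (e : D.OutEdge v) :
    (D.path D.root e.1).length = (D.path D.root v).length + 1 := by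
  rw [e.path_root_eq, Walk.length_concat]

lemma Below.getVert {u x : V} (h : D.Below u x) :
    (D.path D.root x).getVert (D.path D.root u).length = u := by
  rw [h.path_eq, Walk.getVert_append]; simp

lemma OutEdge.eq_of_below {v x : V} {e e' : D.OutEdge v} (h : D.Below e.1 x)
    (h' : D.Below e'.1 x) : e = e' := by
  apply Subtype.ext
  rw [← h.getVert, ← h'.getVert, e.length_path, e'.length_path]

lemma OutEdge.not_below {v : V} (e : D.OutEdge v) : ¬ D.Below e.1 v := e.notMem_support

lemma Below.eq_or_exists {v x : V} (h : D.Below v x) :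
    x = v ∨ ∃ e : D.OutEdge v, D.Below e.1 x := by
  rcases hq : D.path v x with _ | ⟨hadj, q⟩
  · exact Or.inl rfl
  · rename_i u
    right
    have hu : u ∈ (D.path v x).support := by rw [hq]; simp
    have hux := ((h.mem_support_iff u).1 hu)
    refine ⟨⟨u, hadj, ?_⟩, hux.2⟩
    have hp := (D.path_isPath D.root x).isTrail.edges_nodup
    rw [h.path_eq, Walk.edges_append, hq, Walk.edges_cons] at hp
    intro hs
    rw [D.mem_edges_path_comm] at hs
    exact List.disjoint_of_nodup_append hp hs (by simp)

lemma OutEdge.path_eq_cons {v x : V} (e : D.OutEdge v) (h : D.Below e.1 x) :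
    D.path v x = Walk.cons e.2.1 (D.path e.1 x) := by
  have h1 := (e.below.trans h)
  have h2 : e.1 ∈ (D.path v x).support := (h1.mem_support_iff _).2 ⟨e.below, h⟩
  rw [D.path_eq_append h2, ← eq_path (p := Walk.cons e.2.1 .nil) (by simpa using e.2.1.ne)]
  rfl

lemma OutEdge.mem_edges_path {v x : V} (e : D.OutEdge v) (h : D.Below e.1 x) :
    s(v, e.1) ∈ (D.path v x).edges := by
  rw [e.path_eq_cons h]; simp

lemma OutEdge.below_of_mem_edges {v w : V} (e : D.OutEdge v)
    (h : s(v, e.1) ∈ (D.path v w).edges) : D.Below e.1 w := by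
  have hv : D.path v w = Walk.cons e.2.1 (D.path e.1 w) := by
    have h2 : e.1 ∈ (D.path v w).support := Walk.snd_mem_support_of_mem_edges _ h
    rw [D.path_eq_append h2, ← eq_path (p := Walk.cons e.2.1 .nil) (by simpa using e.2.1.ne)]
    rfl
  have hp := D.path_isPath v w
  rw [hv] at hp
  have hq : ((D.path D.root v).append (Walk.cons e.2.1 (D.path e.1 w))).IsPath := by
    rw [D.isTree.isAcyclic.isPath_iff_isChain, Walk.edges_append, List.isChain_append]
    refine ⟨(D.isTree.isAcyclic.isPath_iff_isChain _).1 (D.path_isPath _ _),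
      (D.isTree.isAcyclic.isPath_iff_isChain _).1 hp, ?_⟩
    rintro x hx y hy rfl
    simp only [Walk.edges_cons, List.head?_cons, Option.mem_def, Option.some.injEq] at hy
    apply e.2.2
    rw [D.mem_edges_path_comm, hy]
    exact List.mem_of_getLast? hx
  rw [Below, ← eq_path hq, Walk.mem_support_append_iff]
  right
  simp

/-- Induction from the leaves towards the root: an outward step increases the distance from the
root, which is bounded by the number of vertices. -/
lemma subtree_induction {P : V → Prop} (h : ∀ v, (∀ e : D.OutEdge v, P e.1) → P v) (v : V) :
    P v := by
  obtain ⟨n, hn⟩ : ∃ n, n = Fintype.card V - (D.path D.root v).length := ⟨_, rfl⟩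
  induction n using Nat.strong_induction_on generalizing v with
  | _ n ih =>
    refine h v fun e => ih _ ?_ e.1 rfl
    have := e.length_path
    have h1 := (D.path_isPath D.root e.1).length_lt
    omega

end Paths

/-! ### Valencies, leaves and outward edges. -/

section Valency

variable {D}

lemma exists_parent {v : V} (hv : v ≠ D.root) : ∃ y, D.graph.Adj v y ∧
    ∀ u, D.graph.Adj v u → (s(v, u) ∈ (D.path v D.root).edges ↔ u = y) := by
  refine ⟨(D.path v D.root).snd, (D.path v D.root).adj_snd (SimpleGraph.Walk.not_nil_of_ne hv),
    fun u hu => ⟨fun h => ?_, ?_⟩⟩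
  · exact D.isTree.isAcyclic.eq_snd_of_adj_start (D.path_isPath _ _) hu
      (SimpleGraph.Walk.snd_mem_support_of_mem_edges _ h)
  · rintro rfl
    exact SimpleGraph.Walk.mk_start_snd_mem_edges (SimpleGraph.Walk.not_nil_of_ne hv)

lemma card_outEdge_add_one {v : V} (hv : v ≠ D.root) :
    Fintype.card (D.OutEdge v) + 1 = D.valency v := by
  classical
  obtain ⟨y, hy, h⟩ := exists_parent hv
  have : D.graph.neighborSet v =
      insert y {u | D.graph.Adj v u ∧ s(v, u) ∉ (D.path v D.root).edges} := by
    ext u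
    simp only [SimpleGraph.mem_neighborSet, Set.mem_insert_iff, Set.mem_ofPred_eq]
    constructor
    · intro hu
      by_cases huy : u = y
      · exact Or.inl huy
      · exact Or.inr ⟨hu, fun hs => huy ((h u hu).1 hs)⟩
    · rintro (rfl | hu)
      · exact hy
      · exact hu.1
  rw [valency, this, Set.ncard_insert_of_notMem _ (Set.toFinite _), ← Nat.card_eq_fintype_card,
    ← Nat.card_coe_set_eq]
  · rfl
  · rintro ⟨hy1, hy2⟩
    exact hy2 ((h y hy1).2 rfl)

lemma Node.ne_root (v : D.Node) : v.1 ≠ D.root := by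
  intro h
  have h1 := v.2
  have h2 := D.root_leaf
  rw [valency, h] at h1
  omega

lemma Node.card_outEdge (v : D.Node) : Fintype.card (D.OutEdge v.1) = D.valency v.1 - 2 + 1 := by
  have h1 := card_outEdge_add_one v.ne_root
  have h2 := v.2
  omega

lemma valency_cases {v : V} (hv : v ≠ D.root) : D.valency v = 1 ∨ 3 ≤ D.valency v := by
  have h1 := card_outEdge_add_one hv
  have h2 := D.valency_ne_two v
  rw [← valency] at h2
  omega

lemma isEmpty_outEdge {v : V} (hv : v ≠ D.root) (h : D.valency v = 1) : IsEmpty (D.OutEdge v) := by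
  have h1 := card_outEdge_add_one hv
  exact Fintype.card_eq_zero_iff.1 (by omega)

lemma below_leaf_iff {v x : V} (hv : v ≠ D.root) (h : D.valency v = 1) :
    D.Below v x ↔ x = v := by
  constructor
  · intro hb
    rcases hb.eq_or_exists with h1 | ⟨e, -⟩
    · exact h1
    · exact ((isEmpty_outEdge hv h).false e).elim
  · rintro rfl
    exact Below.refl _

lemma OutEdge.ne_root {v : V} (e : D.OutEdge v) : e.1 ≠ D.root := by
  intro h
  exact e.notMem_support (by rw [h]; exact SimpleGraph.Walk.start_mem_support _)

variable (D) in
-- The root is a leaf, so everything else lies beyond its only neighbour. Statements about the part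
-- beyond a vertex become global when applied to this neighbour.
lemma exists_top : ∃ u : D.OutEdge D.root, (∀ e, e = u) ∧ ∀ x, x ≠ D.root → D.Below u.1 x := by
  obtain ⟨u, hu⟩ := Set.ncard_eq_one.1 D.root_leaf
  have hadj : ∀ y, D.graph.Adj D.root y ↔ y = u := fun y => by
    rw [← SimpleGraph.mem_neighborSet, hu, Set.mem_singleton_iff]
  have key : ∀ e e' : D.OutEdge D.root, e = e' := fun e e' =>
    Subtype.ext (((hadj _).1 e.2.1).trans ((hadj _).1 e'.2.1).symm)
  refine ⟨⟨u, (hadj u).2 rfl, by simp [path_self]⟩, fun e => key _ _, fun x hx => ?_⟩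
  rcases (Below.root x).eq_or_exists with h | ⟨e, he⟩
  · exact (hx h).elim
  · rwa [key e _] at he

lemma weight_outEdge_pos (v : D.Node) (e : D.OutEdge v.1) : 0 < D.weight v.1 e.1 :=
  D.weight_pos _ _ v.2 e.2.1 fun p hp => by rw [eq_path hp]; exact e.2.2

lemma exists_leaf_below (v : V) (hv : v ≠ D.root) : ∃ w : D.Var, D.Below v w.1 := by
  induction v using subtree_induction (D := D) with
  | h v ih =>
    rcases valency_cases hv with h | h
    · exact ⟨⟨v, h, hv⟩, Below.refl v⟩
    · have := card_outEdge_add_one hv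
      obtain ⟨e⟩ : Nonempty (D.OutEdge v) := Fintype.card_pos_iff.1 (by omega)
      obtain ⟨w, hw⟩ := ih e e.ne_root
      exact ⟨w, e.below.trans hw⟩

variable (D) in
lemma nonempty_var : Nonempty D.Var := by
  obtain ⟨u, -⟩ := D.exists_top
  obtain ⟨w, -⟩ := exists_leaf_below u.1 u.ne_root
  exact ⟨w⟩

end Valency

/-! ### Linking numbers as a recursion along the tree. -/

section Linking

/-- The product of the weights adjacent to, but not on, the path from the root to `w`, at the
vertices of this path from `u` on. -/
def linkingFrom (u w : V) : ℕ :=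
  open Classical in
  ∏ x : V with D.Below u x ∧ D.Below x w, D.offPathWeight D.root w x

variable {D}

lemma offPathWeight_root_of_below {v w : V} (e : D.OutEdge v) (h : D.Below e.1 w) :
    open Classical in
    D.offPathWeight D.root w v = ∏ e' ∈ Finset.univ.erase e, D.weight v e'.1 := by
  classical
  rw [offPathWeight]
  symm
  refine Finset.prod_bij (fun e' _ => e'.1) ?_ ?_ ?_ ?_
  · intro e' he'
    simp only [Finset.mem_filter, Finset.mem_univ, true_and]
    refine ⟨e'.2.1, fun hs => ?_⟩
    rw [(e.below.trans h).path_eq, SimpleGraph.Walk.edges_append, List.mem_append] at hs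
    rcases hs with hs | hs
    · exact e'.2.2 ((D.mem_edges_path_comm).1 hs)
    · exact Finset.ne_of_mem_erase he' (OutEdge.eq_of_below (e'.below_of_mem_edges hs) h)
  · intro a _ b _ hab
    exact Subtype.ext hab
  · intro u hu
    simp only [Finset.mem_filter, Finset.mem_univ, true_and] at hu
    rw [(e.below.trans h).path_eq, SimpleGraph.Walk.edges_append, List.mem_append, not_or] at hu
    refine ⟨⟨u, hu.1, fun hs => hu.2.1 ((D.mem_edges_path_comm).1 hs)⟩, ?_, rfl⟩
    simp only [Finset.mem_erase, Finset.mem_univ, and_true]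
    rintro rfl
    exact hu.2.2 (OutEdge.mem_edges_path (D := D) ⟨u, _⟩ h)
  · intro _ _; rfl

/-- The only edge at a leaf lies on the path, so the product is empty. This makes arbitrary weights
at leaves harmless. -/
lemma offPathWeight_leaf {w : V} (h : D.valency w = 1) (a : V) (ha : a ≠ w) :
    D.offPathWeight a w w = 1 := by
  classical
  rw [offPathWeight]
  apply Finset.prod_eq_one
  intro u hu
  simp only [Finset.mem_filter, Finset.mem_univ, true_and] at hu
  exfalso
  apply hu.2
  obtain ⟨y, hy⟩ := Set.ncard_eq_one.1 h
  have hadj : ∀ z, D.graph.Adj w z ↔ z = y := fun z => by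
    rw [← SimpleGraph.mem_neighborSet, hy, Set.mem_singleton_iff]
  have h1 := (D.path w a).adj_snd (SimpleGraph.Walk.not_nil_of_ne ha.symm)
  rw [(hadj u).1 hu.1, ← (hadj _).1 h1, mem_edges_path_comm]
  exact SimpleGraph.Walk.mk_start_snd_mem_edges (SimpleGraph.Walk.not_nil_of_ne ha.symm)

lemma linkingFrom_leaf (w : D.Var) : D.linkingFrom w.1 w.1 = 1 := by
  classical
  rw [linkingFrom]
  apply Finset.prod_eq_one
  intro x hx
  simp only [Finset.mem_filter, Finset.mem_univ, true_and] at hx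
  rw [(below_leaf_iff w.2.2 w.2.1).1 hx.1]
  exact offPathWeight_leaf w.2.1 _ w.2.2.symm

/-- The edge of `v` towards the root and the edge `e` are on the path, so `v` contributes just the
weights of its other outward edges. Both inductions, on points and on monomials, reproduce this
recursion. -/
lemma linkingFrom_outEdge {v w : V} (e : D.OutEdge v) (h : D.Below e.1 w) :
    open Classical in
    D.linkingFrom v w = (∏ e' ∈ Finset.univ.erase e, D.weight v e'.1) * D.linkingFrom e.1 w := by
  classical
  rw [← offPathWeight_root_of_below e h, linkingFrom, linkingFrom]
  rw [← Finset.prod_insert (f := fun x => D.offPathWeight D.root w x) (a := v)]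
  · congr 1
    ext x
    simp only [Finset.mem_filter, Finset.mem_univ, true_and, Finset.mem_insert]
    constructor
    · rintro ⟨h1, h2⟩
      rcases h1.eq_or_exists with rfl | ⟨e', he'⟩
      · exact Or.inl rfl
      · rw [OutEdge.eq_of_below (he'.trans h2) h] at he'
        exact Or.inr ⟨he', h2⟩
    · rintro (rfl | h1)
      · exact ⟨Below.refl _, e.below.trans h⟩
      · exact ⟨e.below.trans h1.1, h1.2⟩
  · simp [e.not_below]

lemma linking_root (u : D.OutEdge D.root) (hu : ∀ e, e = u) (w : D.Var) (h : D.Below u.1 w.1) :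
    D.linking D.root w.1 = D.linkingFrom u.1 w.1 := by
  classical
  have h1 := linkingFrom_outEdge u h
  rw [Finset.prod_eq_one, one_mul] at h1
  · rw [← h1, linking, linkingFrom]
    congr 1
    ext x
    simp only [Finset.mem_filter, Finset.mem_univ, true_and]
    exact (Below.root w.1).mem_support_iff x
  · intro e he
    exact (Finset.ne_of_mem_erase he (hu e)).elim

/-- Leaving out `v` amounts to starting at the next vertex, and leaving out `w` changes nothing
because a leaf contributes 1. -/
lemma linking'_eq_linkingFrom {v : V} (e : D.OutEdge v) (w : D.Var) (h : D.Below e.1 w.1) :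
    D.linking' v w.1 = D.linkingFrom e.1 w.1 := by
  classical
  have hv : D.Below v w.1 := e.below.trans h
  rw [linking', linkingFrom, ← Finset.prod_filter_mul_prod_filter_not
    (Finset.univ.filter fun x => D.Below e.1 x ∧ D.Below x w.1) (fun x => x ≠ w.1)
    (fun x => D.offPathWeight D.root w.1 x)]
  rw [Finset.prod_eq_one (s := Finset.filter (fun x => ¬ x ≠ w.1) _), mul_one]
  · rw [Finset.filter_filter]
    have hset : ∀ x, (x ∈ (D.path v w.1).support ∧ x ≠ v ∧ x ≠ w.1) ↔
        ((D.Below e.1 x ∧ D.Below x w.1) ∧ x ≠ w.1) := by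
      intro x
      rw [hv.mem_support_iff]
      constructor
      · rintro ⟨⟨h1, h2⟩, h3, h4⟩
        rcases h1.eq_or_exists with h5 | ⟨e', he'⟩
        · exact (h3 h5).elim
        · rw [OutEdge.eq_of_below (he'.trans h2) h] at he'
          exact ⟨⟨he', h2⟩, h4⟩
      · rintro ⟨⟨h1, h2⟩, h3⟩
        refine ⟨⟨e.below.trans h1, h2⟩, ?_, h3⟩
        rintro rfl
        exact e.not_below h1
    refine Finset.prod_congr (Finset.filter_congr fun x _ => hset x) fun x hx => ?_
    simp only [Finset.mem_filter, Finset.mem_univ, true_and] at hx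
    rw [offPathWeight, offPathWeight]
    congr 1
    ext y
    simp only [Finset.mem_filter, Finset.mem_univ, true_and]
    rw [hv.mem_edges_iff (e.below.trans hx.1.1) hx.1.2]
    rintro rfl
    exact e.not_below hx.1.1
  · intro x hx
    simp only [Finset.mem_filter, not_not] at hx
    rw [hx.2]
    exact offPathWeight_leaf w.2.1 _ w.2.2.symm

end Linking

/-- In a tree the numbers δ_v - 2 add up to -2. Each leaf contributes -1, so the nodes contribute
the number of leaves minus 2, and the root is a leaf without a variable. -/
lemma card_equations_add_one :
    Fintype.card (Σ v : D.Node, Fin (D.valency v.1 - 2)) + 1 = Fintype.card D.Var := by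
  classical
  have hdeg : ∀ v, D.graph.degree v = D.valency v := fun v => by
    rw [valency, ← SimpleGraph.card_neighborSet_eq_degree, ← Nat.card_eq_fintype_card,
      Nat.card_coe_set_eq]
  have h1 := D.graph.sum_degrees_eq_twice_card_edges
  have h2 := D.isTree.card_edgeFinset
  simp only [hdeg] at h1
  have h3 : ∀ v, D.valency v = 1 ∨ 3 ≤ D.valency v := fun v => by
    by_cases hv : v = D.root
    · subst hv; exact Or.inl D.root_leaf
    · exact valency_cases hv
  -- Adding 1 at each leaf keeps the count free of negative terms in ℕ.
  have h4 : ∑ v, (D.valency v + (if D.valency v = 1 then 1 else 0)) =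
      ∑ v, (2 + if 3 ≤ D.valency v then D.valency v - 2 else 0) := by
    refine Finset.sum_congr rfl fun v _ => ?_
    rcases h3 v with h | h
    · simp [h]
    · simp only [h, if_true]
      split_ifs <;> omega
  rw [Finset.sum_add_distrib, Finset.sum_add_distrib, h1, Finset.sum_const, Finset.card_univ,
    smul_eq_mul, ← Finset.sum_filter, ← Finset.sum_filter, Finset.sum_const, smul_eq_mul,
    mul_one] at h4
  have h5 : Fintype.card (Σ v : D.Node, Fin (D.valency v.1 - 2)) =
      ∑ v with 3 ≤ D.valency v, (D.valency v - 2) := by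
    rw [Fintype.card_sigma]
    simp only [Fintype.card_fin]
    rw [Finset.sum_subtype (p := fun v => 3 ≤ D.valency v) _ (by simp) (fun v => D.valency v - 2)]
  have h6 : Fintype.card D.Var + 1 = (Finset.univ.filter fun v => D.valency v = 1).card := by
    rw [← Finset.card_erase_add_one (a := D.root)
      (Finset.mem_filter.2 ⟨Finset.mem_univ _, D.root_leaf⟩), Fintype.card_of_subtype]
    intro v
    simp [and_comm]
  omega

end RootedSpliceDiagram

/-! ### Matrices with nonvanishing maximal minors. -/

section LinearAlgebra

lemma exists_equiv_ne {E : Type*} [Fintype E] [DecidableEq E] {k : ℕ}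
    (hE : Fintype.card E = k + 1) (e : E) : Nonempty (Fin k ≃ {x : E // x ≠ e}) :=
  ⟨(Fintype.equivFinOfCardEq (by simp [Fintype.card_subtype_compl, hE])).symm⟩

lemma sum_eq_add_sum_equiv_ne {E : Type*} [Fintype E] [DecidableEq E] {k : ℕ} {e : E}
    (f : Fin k ≃ {x : E // x ≠ e}) {M : Type*} [AddCommMonoid M] (g : E → M) :
    ∑ x, g x = g e + ∑ j, g (f j) := by
  rw [← Finset.add_sum_erase _ _ (Finset.mem_univ e), Equiv.sum_comp f (fun x => g x.1)]
  congr 1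
  exact Finset.sum_subtype _ (by simp) g

/-- A `k × (k + 1)` matrix all of whose maximal minors are nonzero has a kernel vector without
zero entries, and its row space is the orthogonal complement of this vector. -/
lemma exists_kernel_vector {E : Type*} [Fintype E] [DecidableEq E] {k : ℕ}
    (hE : Fintype.card E = k + 1) (A : Matrix (Fin k) E ℂ)
    (hA : ∀ f : Fin k → E, Function.Injective f → (A.submatrix id f).det ≠ 0) (e₀ : E) :
    ∃ c : E → ℂ, (∀ e, c e ≠ 0) ∧ c e₀ = 1 ∧ (∀ i, ∑ e, A i e * c e = 0) ∧
      ∀ e, ∃ b : Fin k → ℂ, ∀ x,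
        (if x = e then 1 else 0) - c e * (if x = e₀ then 1 else 0) = ∑ i, b i * A i x := by
  obtain ⟨c, hc, hc0⟩ : ∃ c : E → ℂ, A.mulVec c = 0 ∧ c ≠ 0 := by
    have h := LinearMap.ker_ne_bot_of_finrank_lt (f := A.mulVecLin) (by simp [hE])
    obtain ⟨c, hc, h0⟩ := Submodule.exists_mem_ne_zero_of_ne_bot h
    exact ⟨c, by simpa using hc, h0⟩
  -- If an entry vanished, the remaining entries would lie in the kernel of an invertible maximal
  -- minor.
  have hne : ∀ e, c e ≠ 0 := by
    intro e he
    obtain ⟨f⟩ := exists_equiv_ne hE e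
    have h1 : (A.submatrix id (fun j => (f j).1)).mulVec (fun j => c (f j)) = 0 := by
      ext i
      have := congrFun hc i
      rw [Matrix.mulVec, dotProduct, sum_eq_add_sum_equiv_ne f, he, mul_zero, zero_add] at this
      exact this
    have h2 := Matrix.eq_zero_of_mulVec_eq_zero
      (hA (fun j => (f j).1) (Subtype.val_injective.comp f.injective)) h1
    apply hc0
    ext x
    by_cases hx : x = e
    · rw [hx, he]; rfl
    · have := congrFun h2 (f.symm ⟨x, hx⟩)
      simpa using this
  have hk : ∀ i, ∑ e, A i e * (c e / c e₀) = 0 := by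
    intro i
    have := congrFun hc i
    simp only [mul_div_assoc', ← Finset.sum_div]
    rw [show ∑ e, A i e * c e = 0 from this, zero_div]
  refine ⟨fun e => c e / c e₀, fun e => div_ne_zero (hne e) (hne e₀), div_self (hne e₀), hk, ?_⟩
  intro e
  by_cases he : e = e₀
  · refine ⟨0, fun x => ?_⟩
    subst he
    simp [div_self (hne e)]
  · obtain ⟨f⟩ := exists_equiv_ne hE e₀
    -- The rows of the inverse of this minor combine the rows of `A` into unit vectors away from
    -- `e₀`; orthogonality to `c` then forces the entry at `e₀`.
    set B := A.submatrix id (fun j => (f j).1) with hB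
    have hdet : IsUnit B.det :=
      (hA (fun j => (f j).1) (Subtype.val_injective.comp f.injective)).isUnit
    have hinv := Matrix.nonsing_inv_mul B hdet
    have hrow : ∀ j l, ∑ i, B⁻¹ j i * A i (f l) = if j = l then 1 else 0 := fun j l => by
      have := congrFun (congrFun hinv j) l
      rwa [Matrix.mul_apply, Matrix.one_apply] at this
    obtain ⟨j, hj⟩ := f.surjective ⟨e, he⟩
    refine ⟨fun i => B⁻¹ j i, fun x => ?_⟩
    by_cases hx : x = e₀
    · subst hx
      have h1 : ∀ i, A i x = - ∑ l, A i (f l) * (c (f l) / c x) := fun i => by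
        have := hk i
        rw [sum_eq_add_sum_equiv_ne f, div_self (hne x), mul_one] at this
        exact eq_neg_of_add_eq_zero_left this
      simp only [h1, mul_neg, Finset.mul_sum, Finset.sum_neg_distrib]
      rw [Finset.sum_comm]
      simp only [← mul_assoc, ← Finset.sum_mul, hrow]
      simp [hj, Ne.symm he]
    · obtain ⟨l, hl⟩ := f.surjective ⟨x, hx⟩
      have := hrow j l
      rw [hl] at this
      rw [this]
      have h2 : (x = e) ↔ j = l := by
        rw [← f.injective.eq_iff, hj, hl, Subtype.mk.injEq, eq_comm]
      simp [hx, h2]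

end LinearAlgebra

/-! ### Counting points of slices of a set stable under ℂˣ. -/

section Counting

lemma exists_unit_pow_eq {N : ℕ} (hN : 0 < N) (b : ℂˣ) : ∃ t : ℂˣ, t ^ N = b := by
  obtain ⟨t, ht⟩ := IsAlgClosed.exists_pow_nat_eq (b : ℂ) hN
  have h0 : t ≠ 0 := by
    rintro rfl
    rw [zero_pow hN.ne'] at ht
    exact b.ne_zero ht.symm
  exact ⟨Units.mk0 t h0, Units.ext (by simpa using ht)⟩

lemma card_unit_pow_eq {N : ℕ} (hN : 0 < N) (b : ℂˣ) : Nat.card {t : ℂˣ // t ^ N = b} = N := by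
  obtain ⟨s, hs⟩ := exists_unit_pow_eq hN b
  have : NeZero N := ⟨hN.ne'⟩
  refine Eq.trans (Nat.card_congr ?_) (Complex.card_rootsOfUnity N)
  refine ⟨fun t => ⟨t.1 / s, ?_⟩, fun t => ⟨t.1 * s, ?_⟩, fun t => ?_, fun t => ?_⟩
  · rw [mem_rootsOfUnity, div_pow, t.2, hs, div_self']
  · rw [mul_pow, (mem_rootsOfUnity _ _).1 t.2, one_mul, hs]
  · simp
  · simp

lemma card_sigma_const {A : Type*} {B : A → Type*} [Finite A] {N : ℕ} (hN : 0 < N)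
    (h : ∀ a, Nat.card (B a) = N) : Nat.card (Σ a, B a) = Nat.card A * N := by
  have := Fintype.ofFinite A
  have : ∀ a, Finite (B a) := fun a => Nat.finite_of_card_ne_zero (by rw [h]; exact hN.ne')
  rw [Nat.card_sigma]
  simp [h]

variable {σ : Type*}

/-- The action of `ℂˣ` on the torus with weights `l`. -/
def weightedScale (l : σ → ℕ) (t : ℂˣ) (z : σ → ℂˣ) : σ → ℂˣ := fun w => t ^ l w * z w

lemma zpow_finset_sum {G ι : Type*} [CommGroup G] (t : G) (s : Finset ι) (f : ι → ℤ) :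
    t ^ (∑ i ∈ s, f i) = ∏ i ∈ s, t ^ f i := by
  classical
  induction s using Finset.induction_on with
  | empty => simp
  | insert a s ha ih => rw [Finset.sum_insert ha, Finset.prod_insert ha, zpow_add, ih]

lemma prod_weightedScale_zpow [Fintype σ] (l : σ → ℕ) (t : ℂˣ) (z : σ → ℂˣ) (α : σ → ℤ) :
    ∏ w, weightedScale l t z w ^ α w = t ^ (∑ w, α w * l w) * ∏ w, z w ^ α w := by
  simp only [weightedScale, mul_zpow, Finset.prod_mul_distrib]
  congr 1
  rw [zpow_finset_sum]
  refine Finset.prod_congr rfl fun w _ => ?_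
  rw [← zpow_natCast, ← zpow_mul, mul_comm]

lemma weightedScale_inv_cancel (l : σ → ℕ) (t : ℂˣ) (z : σ → ℂˣ) :
    weightedScale l t (weightedScale l t⁻¹ z) = z := by
  ext w; simp [weightedScale]

lemma weightedScale_cancel_inv (l : σ → ℕ) (t : ℂˣ) (z : σ → ℂˣ) :
    weightedScale l t⁻¹ (weightedScale l t z) = z := by
  ext w; simp [weightedScale]

/-- If a subset of the torus is stable under the action of `ℂˣ` with weights `l`, and the slice
`z_w = 1` has as many points as it should for one `w`, then so has every slice. -/
lemma ncard_slice [Fintype σ] {l : σ → ℕ} {X : Set (σ → ℂˣ)} (hX : ∀ t, ∀ z ∈ X, weightedScale l t z ∈ X)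
    {w₀ : σ} (hw₀ : 0 < l w₀) (hcard : {z ∈ X | z w₀ = 1}.ncard = l w₀) (α : σ → ℤ) {N : ℕ}
    (hN : 0 < N) (hα : ∑ w, α w * l w = N) (b : ℂˣ) :
    {z ∈ X | ∏ w, z w ^ α w = b}.ncard = N := by
  set K := {z ∈ X | z w₀ = 1} with hK
  set Y := {z ∈ X | ∏ w, z w ^ α w = b} with hY
  -- Double counting through y = t · z. For each y there are `l w₀` values of t that normalise its
  -- coordinate at `w₀` to 1; for each z there are N values of t that give the monomial the value b.
  -- With `l w₀` points z, comparison leaves N points y.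
  let e : (Σ y : Y, {t : ℂˣ // t ^ l w₀ = y.1 w₀}) ≃
      (Σ z : K, {t : ℂˣ // t ^ N = b / ∏ w, z.1 w ^ α w}) :=
    { toFun := fun p => ⟨⟨weightedScale l p.2.1⁻¹ p.1.1, hX _ _ p.1.2.1, by
          simp [weightedScale, p.2.2]⟩, ⟨p.2.1, by
          rw [prod_weightedScale_zpow, p.1.2.2, hα]; simp⟩⟩
      invFun := fun p => ⟨⟨weightedScale l p.2.1 p.1.1, hX _ _ p.1.2.1, by
          rw [prod_weightedScale_zpow, hα, zpow_natCast, p.2.2]; simp⟩, ⟨p.2.1, by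
          simp [weightedScale, p.1.2.2]⟩⟩
      left_inv := fun p => by
        rcases p with ⟨⟨y, hy⟩, ⟨t, ht⟩⟩
        refine Sigma.ext (Subtype.ext (weightedScale_inv_cancel l t y)) ?_
        refine (Subtype.heq_iff_coe_eq fun s => ?_).2 rfl
        simp only [weightedScale_inv_cancel]
      right_inv := fun p => by
        rcases p with ⟨⟨y, hy⟩, ⟨t, ht⟩⟩
        refine Sigma.ext (Subtype.ext (weightedScale_cancel_inv l t y)) ?_
        refine (Subtype.heq_iff_coe_eq fun s => ?_).2 rfl
        simp only [weightedScale_cancel_inv] }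
  rw [← Nat.card_coe_set_eq] at hcard ⊢
  have : Finite K := Nat.finite_of_card_ne_zero (by rw [hcard]; exact hw₀.ne')
  have h1 : Nat.card (Σ z : K, {t : ℂˣ // t ^ N = b / ∏ w, z.1 w ^ α w}) = l w₀ * N := by
    rw [card_sigma_const hN fun z => card_unit_pow_eq hN _, hcard]
  have hfin : Finite (Σ z : K, {t : ℂˣ // t ^ N = b / ∏ w, z.1 w ^ α w}) :=
    Nat.finite_of_card_ne_zero (by rw [h1]; positivity)
  have hfin' := Finite.of_equiv _ e.symm
  -- Roots exist, so `Y` is a quotient of the left-hand set, which is finite because the right-hand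
  -- one is.
  have : Finite Y := Finite.of_surjective
    (fun p : (Σ y : Y, {t : ℂˣ // t ^ l w₀ = y.1 w₀}) => p.1) fun y => by
      obtain ⟨t, ht⟩ := exists_unit_pow_eq hw₀ (y.1 w₀)
      exact ⟨⟨y, t, ht⟩, rfl⟩
  have h2 := Nat.card_congr e
  rw [h1, card_sigma_const hw₀ fun y => card_unit_pow_eq hw₀ _, mul_comm] at h2
  exact Nat.eq_of_mul_eq_mul_left hw₀ h2

end Counting

/-! ### Division with remainder for monomials modulo a congruence. -/

section Generation

variable {σ : Type*}

/-- Modulo the congruence `r`, every exponent vector with support in `U` is the sum of a multiple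
of `α` and one of at most `N` fixed exponent vectors with support in `U`. -/
def GeneratedBy (r : AddCon (σ →₀ ℕ)) (U : Set σ) (α : σ →₀ ℕ) (N : ℕ) : Prop :=
  ∃ B : Finset (σ →₀ ℕ), B.card ≤ N ∧ (∀ b ∈ B, ↑b.support ⊆ U) ∧
    ∀ m : σ →₀ ℕ, ↑m.support ⊆ U → ∃ i : ℕ, ∃ b ∈ B, r m (i • α + b)

variable {r : AddCon (σ →₀ ℕ)} {U : Set σ}

lemma support_add_subset {m m' : σ →₀ ℕ} (h : ↑m.support ⊆ U) (h' : ↑m'.support ⊆ U) :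
    ↑(m + m').support ⊆ U := by
  classical
  intro x hx
  rcases Finset.mem_union.1 (Finsupp.support_add hx) with hx | hx
  exacts [h hx, h' hx]

lemma support_sum_subset {ι : Type*} {s : Finset ι} {f : ι → σ →₀ ℕ}
    (h : ∀ i ∈ s, ↑(f i).support ⊆ U) : ↑(∑ i ∈ s, f i).support ⊆ U := by
  classical
  induction s using Finset.induction_on with
  | empty => simp
  | insert a s ha ih =>
    rw [Finset.sum_insert ha]
    exact support_add_subset (h a (by simp)) (ih fun i hi => h i (by simp [hi]))

lemma support_nsmul_subset {m : σ →₀ ℕ} (h : ↑m.support ⊆ U) (i : ℕ) :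
    ↑(i • m).support ⊆ U :=
  (Finset.coe_subset.2 Finsupp.support_smul).trans h

/-- If all variables in `U` generate with the expected number of generators, the exponent vectors
that are not divisible by `α` fall into the expected number of classes. -/
lemma exists_remainders [Fintype σ] {l : σ → ℕ}
    (h : ∀ w ∈ U, GeneratedBy r U (Finsupp.single w 1) (l w)) (α : σ →₀ ℕ)
    (hα : ↑α.support ⊆ U) :
    ∃ B : Finset (σ →₀ ℕ), B.card ≤ ∑ w, α w * l w ∧ (∀ b ∈ B, ↑b.support ⊆ U) ∧
      ∀ m : σ →₀ ℕ, ↑m.support ⊆ U →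
        (∃ m' : σ →₀ ℕ, ↑m'.support ⊆ U ∧ r m (α + m')) ∨ ∃ b ∈ B, r m b := by
  classical
  obtain ⟨n, hn⟩ : ∃ n, n = ∑ w, α w := ⟨_, rfl⟩
  induction n generalizing α with
  | zero =>
    have h0 : α = 0 := by
      ext w
      exact (Finset.sum_eq_zero_iff.1 hn.symm) w (Finset.mem_univ w)
    subst h0
    exact ⟨∅, by simp, by simp, fun m hm => Or.inl ⟨m, hm, by rw [zero_add]; exact r.refl m⟩⟩
  | succ n ih =>
    obtain ⟨w, -, hw⟩ : ∃ w ∈ Finset.univ, α w ≠ 0 :=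
      Finset.exists_ne_zero_of_sum_ne_zero (by omega)
    have hle : Finsupp.single w 1 ≤ α := by
      rw [Finsupp.single_le_iff]; omega
    obtain ⟨γ, rfl⟩ := exists_add_of_le hle
    have hwU : w ∈ U := hα (by simp)
    have hγ : ↑γ.support ⊆ U := fun x hx => hα (by
      simp only [Finset.mem_coe, Finsupp.mem_support_iff, Finsupp.add_apply] at hx ⊢; omega)
    have hs : ↑(Finsupp.single w 1 : σ →₀ ℕ).support ⊆ U :=
      (Finset.coe_subset.2 Finsupp.support_single_subset).trans (by simpa using hwU)
    have hsum : ∀ f : σ → ℕ, ∑ x, (Finsupp.single w 1 + γ : σ →₀ ℕ) x * f x = f w + ∑ x, γ x * f x := by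
      intro f
      simp [add_mul, Finset.sum_add_distrib, Finsupp.single_apply]
    have hn' : n = ∑ x, γ x := by
      have := hsum 1
      simp only [Pi.one_apply, mul_one] at this
      omega
    obtain ⟨B, hB, hBU, hBm⟩ := ih γ hγ hn'
    obtain ⟨B', hB', hBU', hBm'⟩ := h w hwU
    -- An exponent vector not divisible by `γ` has its remainder in `B`. If m = γ + m', reduce m'
    -- modulo `w`: either a factor `w` remains, and m is divisible by w + γ, or the remainder is `γ`
    -- plus an element of `B'`.
    refine ⟨B ∪ B'.image (γ + ·), ?_, ?_, ?_⟩
    · rw [hsum]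
      have h1 := Finset.card_union_le B (B'.image (γ + ·))
      have h2 := Finset.card_image_le (s := B') (f := (γ + ·))
      omega
    · intro b hb
      rcases Finset.mem_union.1 hb with hb | hb
      · exact hBU b hb
      · obtain ⟨b', hb', rfl⟩ := Finset.mem_image.1 hb
        exact support_add_subset hγ (hBU' b' hb')
    · intro m hm
      rcases hBm m hm with ⟨m', hm', hr⟩ | ⟨b, hb, hr⟩
      · obtain ⟨i, b, hb, hr'⟩ := hBm' m' hm'
        have hr2 := r.trans hr (r.add (r.refl γ) hr')
        rcases i with _ | i
        · right
          refine ⟨γ + b, Finset.mem_union_right _ (Finset.mem_image_of_mem _ hb), ?_⟩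
          simpa using hr2
        · left
          refine ⟨i • Finsupp.single w 1 + b,
            support_add_subset (support_nsmul_subset hs i) (hBU' b hb), ?_⟩
          convert hr2 using 1
          rw [succ_nsmul]; abel
      · exact Or.inr ⟨b, Finset.mem_union_left _ hb, hr⟩

/-- Division by `α` is repeated until a remainder is reached. It stops because each division lowers
the positive weighted degree, which the congruence preserves. -/
lemma GeneratedBy.of_single [Fintype σ] {deg : σ → ℕ} (hdeg : ∀ w, 0 < deg w)
    (hr : ∀ m m', r m m' → ∑ w, m w * deg w = ∑ w, m' w * deg w) {l : σ → ℕ}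
    (h : ∀ w ∈ U, GeneratedBy r U (Finsupp.single w 1) (l w)) {α : σ →₀ ℕ}
    (hα : ↑α.support ⊆ U) (h0 : α ≠ 0) : GeneratedBy r U α (∑ w, α w * l w) := by
  obtain ⟨B, hB, hBU, hBm⟩ := exists_remainders h α hα
  refine ⟨B, hB, hBU, fun m hm => ?_⟩
  have hpos : 0 < ∑ w, α w * deg w := by
    obtain ⟨w, hw⟩ := Finsupp.ne_iff.1 h0
    exact Finset.sum_pos' (fun _ _ => Nat.zero_le _)
      ⟨w, Finset.mem_univ w, Nat.mul_pos (Nat.pos_of_ne_zero hw) (hdeg w)⟩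
  obtain ⟨n, hn⟩ : ∃ n, n = ∑ w, m w * deg w := ⟨_, rfl⟩
  induction n using Nat.strong_induction_on generalizing m with
  | _ n ih =>
    rcases hBm m hm with ⟨m', hm', hr'⟩ | ⟨b, hb, hr'⟩
    · have h1 := hr _ _ hr'
      simp only [Finsupp.add_apply, add_mul, Finset.sum_add_distrib] at h1
      obtain ⟨i, b, hb, h2⟩ := ih _ (by omega) m' hm' rfl
      refine ⟨i + 1, b, hb, ?_⟩
      have h3 := r.trans hr' (r.add (r.refl α) h2)
      convert h3 using 1
      rw [succ_nsmul]; abel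
    · exact ⟨0, b, hb, by simpa using hr'⟩

lemma GeneratedBy.singleton (r : AddCon (σ →₀ ℕ)) (w : σ) :
    GeneratedBy r {w} (Finsupp.single w 1) 1 := by
  refine ⟨{0}, by simp, by simp, fun m hm => ⟨m w, 0, by simp, ?_⟩⟩
  have : m = m w • Finsupp.single w 1 + 0 := by
    classical
    ext x
    by_cases hx : x = w
    · subst hx; simp
    · have : m x = 0 := by
        by_contra h
        exact hx (hm (by simpa using h))
      simp [this, Ne.symm hx]
  rw [← this]
  exact r.refl m

/-- The part of a monomial in each `U e` is a multiple of `β e` plus one of `d e` remainders. As all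
`β e` are congruent, the multiples can be moved into `U e₁`, where division by `γ` leaves one of `N`
remainders. -/
lemma GeneratedBy.iUnion {E : Type*} [Fintype E] [DecidableEq E] {U : E → Set σ}
    (hU : Pairwise fun e e' => Disjoint (U e) (U e')) {β : E → σ →₀ ℕ}
    (hβU : ∀ e, ↑(β e).support ⊆ U e) (hβ : ∀ e e', r (β e) (β e')) {d : E → ℕ}
    (hd : ∀ e, GeneratedBy r (U e) (β e) (d e)) {e₁ : E} {γ : σ →₀ ℕ} {N : ℕ}
    (hγ : GeneratedBy r (U e₁) γ N) :
    GeneratedBy r (⋃ e, U e) γ ((∏ e ∈ Finset.univ.erase e₁, d e) * N) := by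
  classical
  choose B hB hBU hBm using hd
  obtain ⟨B₁, hB₁, hBU₁, hBm₁⟩ := hγ
  let B' : E → Finset (σ →₀ ℕ) := Function.update B e₁ B₁
  have hB'₁ : B' e₁ = B₁ := Function.update_self _ _ _
  have hB' : ∀ e, e ≠ e₁ → B' e = B e := fun e he => Function.update_of_ne he _ _
  have hBU' : ∀ e, ∀ b ∈ B' e, ↑b.support ⊆ U e := by
    intro e b hb
    by_cases he : e = e₁
    · subst he; rw [hB'₁] at hb; exact hBU₁ b hb
    · rw [hB' e he] at hb; exact hBU e b hb
  refine ⟨(Fintype.piFinset B').image fun f => ∑ e, f e, ?_, ?_, ?_⟩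
  · refine Finset.card_image_le.trans ?_
    rw [Fintype.card_piFinset, ← Finset.prod_erase_mul _ _ (Finset.mem_univ e₁), hB'₁]
    refine Nat.mul_le_mul (Finset.prod_le_prod' fun e he => ?_) hB₁
    rw [hB' e (Finset.ne_of_mem_erase he)]
    exact hB e
  · intro b hb
    obtain ⟨f, hf, rfl⟩ := Finset.mem_image.1 hb
    exact support_sum_subset fun e _ =>
      (hBU' e _ (Fintype.mem_piFinset.1 hf e)).trans (Set.subset_iUnion U e)
  · intro m hm
    have hmU : ∀ e, ↑(m.filter (· ∈ U e)).support ⊆ U e := fun e x hx => by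
      rw [Finset.mem_coe, Finsupp.support_filter, Finset.mem_filter] at hx
      exact hx.2
    have hsum : m = ∑ e, m.filter (· ∈ U e) := by
      ext x
      rw [Finsupp.finsetSum_apply]
      by_cases hx : m x = 0
      · rw [hx, Finset.sum_eq_zero]
        intro e _
        rw [Finsupp.filter_apply]
        simp [hx]
      · obtain ⟨e, he⟩ := Set.mem_iUnion.1 (hm (by simpa using hx))
        rw [Finset.sum_eq_single e]
        · rw [Finsupp.filter_apply, if_pos he]
        · intro e' _ hne
          rw [Finsupp.filter_apply, if_neg]
          exact fun h => Set.disjoint_left.1 (hU hne) h he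
        · simp
    choose i b hb hi using fun e => hBm e _ (hmU e)
    -- The multiples of the other `β e`, rewritten as multiples of `β e₁`, join the part in `U e₁`
    -- before it is divided by `γ`.
    obtain ⟨i₁, b₁, hb₁, hi₁⟩ := hBm₁
      (m.filter (· ∈ U e₁) + ∑ e ∈ Finset.univ.erase e₁, i e • β e₁)
      (support_add_subset (hmU e₁)
        (support_sum_subset fun e _ => support_nsmul_subset (hβU e₁) _))
    let b' : E → σ →₀ ℕ := Function.update b e₁ b₁
    have hb'₁ : b' e₁ = b₁ := Function.update_self _ _ _
    have hb' : ∀ e, e ≠ e₁ → b' e = b e := fun e he => Function.update_of_ne he _ _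
    refine ⟨i₁, ∑ e, b' e, Finset.mem_image.2 ⟨b', Fintype.mem_piFinset.2 fun e => ?_, rfl⟩, ?_⟩
    · by_cases he : e = e₁
      · subst he; rwa [hb'₁, hB'₁]
      · rw [hb' e he, hB' e he]; exact hb e
    · have h1 : r (∑ e ∈ Finset.univ.erase e₁, m.filter (· ∈ U e))
          (∑ e ∈ Finset.univ.erase e₁, (i e • β e₁ + b' e)) := by
        refine AddCon.finsetSum r _ fun e he => ?_
        rw [hb' e (Finset.ne_of_mem_erase he)]
        exact r.trans (hi e) (r.add (r.nsmul _ (hβ e e₁)) (r.refl _))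
      have h2 := r.add (r.refl (m.filter (· ∈ U e₁))) h1
      rw [Finset.add_sum_erase _ (fun e => m.filter (· ∈ U e)) (Finset.mem_univ e₁), ← hsum,
        Finset.sum_add_distrib,
        ← add_assoc] at h2
      have h3 := r.trans h2 (r.add hi₁ (r.refl _))
      rwa [add_assoc, ← hb'₁, Finset.add_sum_erase _ _ (Finset.mem_univ e₁)] at h3

end Generation

/-- Two exponent vectors are congruent modulo the ideal `I` if they have the same weighted degree
and the monomials agree modulo `I` up to a nonzero factor. -/
def monomialCon {σ : Type*} [Fintype σ] (I : Ideal (MvPolynomial σ ℂ)) (deg : σ → ℕ) :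
    AddCon (σ →₀ ℕ) where
  r m m' := ∑ w, m w * deg w = ∑ w, m' w * deg w ∧
    ∃ c : ℂˣ, Ideal.Quotient.mk I (monomial m 1) = Ideal.Quotient.mk I (monomial m' (c : ℂ))
  iseqv := by
    refine ⟨fun m => ⟨rfl, 1, rfl⟩, ?_, ?_⟩
    · rintro m m' ⟨h, c, hc⟩
      refine ⟨h.symm, c⁻¹, ?_⟩
      have h1 := congrArg (Ideal.Quotient.mk I (C ((c⁻¹ : ℂˣ) : ℂ)) * ·) hc
      simp only [← map_mul, C_mul_monomial, mul_one, Units.inv_mul] at h1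
      exact h1.symm
    · rintro m m' m'' ⟨h, c, hc⟩ ⟨h', c', hc'⟩
      refine ⟨h.trans h', c * c', ?_⟩
      have h1 := congrArg (Ideal.Quotient.mk I (C (c : ℂ)) * ·) hc'
      simp only [← map_mul, C_mul_monomial, mul_one] at h1
      rw [hc, h1, Units.val_mul]
  add' := by
    rintro m m' n n' ⟨h, c, hc⟩ ⟨h', c', hc'⟩
    refine ⟨?_, c * c', ?_⟩
    · simp only [Finsupp.add_apply, add_mul, Finset.sum_add_distrib, h, h']
    · rw [← mul_one (1 : ℂ), ← monomial_mul, map_mul, hc, hc', ← map_mul, monomial_mul,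
        Units.val_mul]

lemma prod_pow_congr {σ M : Type*} [Fintype σ] [CommMonoid M] {z z' : σ → M} {m : σ →₀ ℕ}
    (h : ∀ w, m w ≠ 0 → z w = z' w) : ∏ w, z w ^ m w = ∏ w, z' w ^ m w := by
  refine Finset.prod_congr rfl fun w _ => ?_
  by_cases hw : m w = 0
  · rw [hw, pow_zero, pow_zero]
  · rw [h w hw]

lemma eval_monomial_one {σ : Type*} [Fintype σ] (z : σ → ℂ) (m : σ →₀ ℕ) :
    eval z (monomial m 1) = ∏ w, z w ^ m w := by
  rw [eval_monomial, one_mul, Finsupp.prod_fintype]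
  simp

/-! ### Leaves beyond a vertex and weighted degrees of the admissible monomials. -/

namespace RootedSpliceDiagram

variable {V : Type*} [Fintype V] {D : RootedSpliceDiagram V}

section Linking

/-- The leaves beyond the vertex `u`, seen from the root. -/
def leavesBelow (D : RootedSpliceDiagram V) (u : V) : Set D.Var := {w | D.Below u w.1}

variable (D) in
lemma Node.nonempty_outEdge (v : D.Node) : Nonempty (D.OutEdge v.1) :=
  Fintype.card_pos_iff.1 (by rw [v.card_outEdge]; exact Nat.succ_pos _)

lemma Var.exists_outEdge (v : D.Node) {w : D.Var} (h : D.Below v.1 w.1) :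
    ∃ e : D.OutEdge v.1, D.Below e.1 w.1 := by
  rcases h.eq_or_exists with h | h
  · have h1 := v.2
    rw [← h, w.2.1] at h1
    omega
  · exact h

lemma leavesBelow_node (v : D.Node) :
    D.leavesBelow v.1 = ⋃ e : D.OutEdge v.1, D.leavesBelow e.1 := by
  ext w
  rw [Set.mem_iUnion]
  exact ⟨fun h => Var.exists_outEdge v h, fun ⟨e, he⟩ => e.below.trans he⟩

lemma leavesBelow_leaf (w : D.Var) : D.leavesBelow w.1 = {w} := by
  ext x
  rw [Set.mem_singleton_iff, Subtype.ext_iff]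
  exact below_leaf_iff w.2.2 w.2.1

lemma disjoint_leavesBelow (v : V) :
    Pairwise fun e e' : D.OutEdge v => Disjoint (D.leavesBelow e.1) (D.leavesBelow e'.1) :=
  fun _ _ hne => Set.disjoint_left.2 fun _ h h' => hne (OutEdge.eq_of_below h h')

lemma linkingFrom_pos (u : V) (hu : u ≠ D.root) (w : D.Var) (h : D.Below u w.1) :
    0 < D.linkingFrom u w.1 := by
  classical
  induction u using subtree_induction (D := D) with
  | h u ih =>
    rcases valency_cases hu with h1 | h1
    · rw [← (below_leaf_iff hu h1).1 h, linkingFrom_leaf]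
      exact one_pos
    · obtain ⟨e, he⟩ := Var.exists_outEdge ⟨u, h1⟩ h
      rw [linkingFrom_outEdge e he]
      exact Nat.mul_pos (Finset.prod_pos fun e' _ => weight_outEdge_pos ⟨u, h1⟩ e')
        (ih e e.ne_root he)

variable (D) in
/-- The weights of the action of `ℂˣ` on the part of the torus that belongs to the leaves
beyond `u`. -/
def linkingBelow (u : V) (w : D.Var) : ℕ :=
  open Classical in
  if D.Below u w.1 then D.linkingFrom u w.1 else 0

lemma linkingBelow_of_below {u : V} {w : D.Var} (h : D.Below u w.1) :
    D.linkingBelow u w = D.linkingFrom u w.1 := if_pos h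

lemma linkingBelow_of_not_below {u : V} {w : D.Var} (h : ¬ D.Below u w.1) :
    D.linkingBelow u w = 0 := if_neg h

lemma linkingBelow_outEdge {v : V} (e : D.OutEdge v) {w : D.Var} (h : D.Below e.1 w.1) :
    open Classical in
    D.linkingBelow v w = (∏ e' ∈ Finset.univ.erase e, D.weight v e'.1) * D.linkingBelow e.1 w := by
  classical
  rw [linkingBelow_of_below (e.below.trans h), linkingBelow_of_below h, linkingFrom_outEdge e h]

end Linking

namespace CurveData

variable (C : D.CurveData)

lemma below_of_exponent_ne_zero (v : D.Node) (e : D.OutEdge v.1) {w : D.Var}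
    (h : C.exponent v e w ≠ 0) : D.Below e.1 w.1 :=
  e.below_of_mem_edges ((C.admissible v e).1 w h)

/-- This is the semigroup condition read as a degree: under the action that belongs to the subtree
beyond `e`, the monomial M_ve has weight d_ve. -/
lemma sum_exponent_mul (v : D.Node) (e : D.OutEdge v.1) :
    ∑ w, C.exponent v e w * D.linkingBelow e.1 w = D.weight v.1 e.1 := by
  rw [(C.admissible v e).2]
  refine Finset.sum_congr rfl fun w _ => ?_
  by_cases h : C.exponent v e w = 0
  · rw [h, zero_mul, zero_mul]
  · have hb := C.below_of_exponent_ne_zero v e h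
    rw [linking'_eq_linkingFrom e w hb, linkingBelow_of_below hb]

lemma exponent_ne_zero (v : D.Node) (e : D.OutEdge v.1) : C.exponent v e ≠ 0 := by
  intro h
  have h1 := C.sum_exponent_mul v e
  have h2 := weight_outEdge_pos v e
  simp only [h, Finsupp.zero_apply, zero_mul, Finset.sum_const_zero] at h1
  omega

/-- The admissible monomials at a node have the same weighted degree. -/
lemma exists_degree (u : V) (v : D.Node) (h : D.Below u v.1) :
    ∃ d, ∀ e, ∑ w, C.exponent v e w * D.linkingBelow u w = d := by
  classical
  induction u using subtree_induction (D := D) with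
  | h u ih =>
    rcases h.eq_or_exists with rfl | ⟨e, he⟩
    · refine ⟨∏ e' : D.OutEdge v.1, D.weight v.1 e'.1, fun e => ?_⟩
      rw [← Finset.prod_erase_mul _ _ (Finset.mem_univ e), ← C.sum_exponent_mul v e,
        Finset.mul_sum]
      refine Finset.sum_congr rfl fun w _ => ?_
      by_cases h0 : C.exponent v e w = 0
      · rw [h0, zero_mul, zero_mul, mul_zero]
      · rw [linkingBelow_outEdge e (C.below_of_exponent_ne_zero v e h0)]
        ring
    · obtain ⟨d, hd⟩ := ih e he
      refine ⟨(∏ e' ∈ Finset.univ.erase e, D.weight u e'.1) * d, fun e₁ => ?_⟩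
      rw [← hd e₁, Finset.mul_sum]
      refine Finset.sum_congr rfl fun w _ => ?_
      by_cases h0 : C.exponent v e₁ w = 0
      · rw [h0, zero_mul, zero_mul, mul_zero]
      · rw [linkingBelow_outEdge e
          (he.trans (e₁.below.trans (C.below_of_exponent_ne_zero v e₁ h0)))]
        ring

/-! ### The equations at a node as proportionality of monomials. -/

section Ratio

/-- The row space is the orthogonal complement of the kernel vector, so M_e - c_e M_{e₀} is a
combination of the equations. The one polynomial identity serves both modulo the ideal and at
points. -/
lemma exists_ratio (v : D.Node) : ∃ c : D.OutEdge v.1 → ℂˣ,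
    (∀ i, ∑ e, C.coeff v i e * (c e : ℂ) = 0) ∧ ∃ e₀, c e₀ = 1 ∧
      ∀ e, ∃ b : Fin (D.valency v.1 - 2) → ℂ, ∀ M : D.OutEdge v.1 → MvPolynomial D.Var ℂ,
        M e - MvPolynomial.C (c e : ℂ) * M e₀ =
          ∑ i, MvPolynomial.C (b i) * ∑ x, MvPolynomial.C (C.coeff v i x) * M x := by
  classical
  obtain ⟨e₀⟩ := v.nonempty_outEdge
  obtain ⟨c, hc, hc0, hk, hb⟩ := exists_kernel_vector v.card_outEdge (C.coeff v)
    (fun f hf => by convert C.minor_ne_zero v f hf) e₀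
  refine ⟨fun e => Units.mk0 (c e) (hc e), by simpa using hk, e₀, Units.ext (by simpa using hc0),
    fun e => ?_⟩
  obtain ⟨b, hb⟩ := hb e
  refine ⟨b, fun M => ?_⟩
  have h1 : ∀ x, (∑ i, MvPolynomial.C (b i) * (MvPolynomial.C (C.coeff v i x) * M x)) =
      MvPolynomial.C ((if x = e then 1 else 0) - c e * (if x = e₀ then 1 else 0)) * M x := by
    intro x
    rw [hb, map_sum, Finset.sum_mul]
    refine Finset.sum_congr rfl fun i _ => ?_
    rw [map_mul, mul_assoc]
  simp only [Finset.mul_sum]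
  rw [Finset.sum_comm]
  simp only [h1, map_sub, map_mul, sub_mul, Finset.sum_sub_distrib, Units.val_mk0]
  simp [apply_ite MvPolynomial.C]

/-- The equations at the node `v` say that the admissible monomials at `v` are proportional to
the numbers `ratio v e`. -/
def ratio (v : D.Node) : D.OutEdge v.1 → ℂˣ := (C.exists_ratio v).choose

lemma mk_monomial_exponent (v : D.Node) (e e' : D.OutEdge v.1) :
    Ideal.Quotient.mk C.ideal (monomial (C.exponent v e) 1) =
      Ideal.Quotient.mk C.ideal
        (monomial (C.exponent v e') ((C.ratio v e / C.ratio v e' : ℂˣ) : ℂ)) := by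
  obtain ⟨-, e₀, -, h⟩ := (C.exists_ratio v).choose_spec
  have key : ∀ e, Ideal.Quotient.mk C.ideal (monomial (C.exponent v e) 1) =
      Ideal.Quotient.mk C.ideal (MvPolynomial.C (C.ratio v e : ℂ) *
        monomial (C.exponent v e₀) 1) := by
    intro e
    obtain ⟨b, hb⟩ := h e
    rw [Ideal.Quotient.eq]
    have h1 := hb fun e => monomial (C.exponent v e) 1
    refine h1 ▸ Ideal.sum_mem _ fun i _ => Ideal.mul_mem_left _ _ ?_
    exact Ideal.subset_span ⟨⟨v, i⟩, rfl⟩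
  have h1 : monomial (C.exponent v e') ((C.ratio v e / C.ratio v e' : ℂˣ) : ℂ) =
      MvPolynomial.C ((C.ratio v e / C.ratio v e' : ℂˣ) : ℂ) * monomial (C.exponent v e') 1 := by
    rw [C_mul_monomial, mul_one]
  rw [h1, map_mul, key e, key e', ← map_mul, ← mul_assoc, ← map_mul MvPolynomial.C,
    ← Units.val_mul, div_mul_cancel]

lemma mem_zeroLocus_iff (z : D.Var → ℂ) : z ∈ zeroLocus ℂ C.ideal ↔
    ∀ v : D.Node, ∃ s, ∀ e, ∏ w, z w ^ C.exponent v e w = C.ratio v e * s := by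
  have heq : ∀ j, aeval z (C.equation j) =
      ∑ e, C.coeff j.1 j.2 e * ∏ w, z w ^ C.exponent j.1 e w := by
    intro j
    rw [equation, map_sum]
    refine Finset.sum_congr rfl fun e _ => ?_
    rw [map_mul, aeval_C, ← eval_monomial_one]
    rfl
  rw [ideal, zeroLocus_span]
  simp only [Set.mem_range, forall_exists_index, forall_apply_eq_imp_iff, Set.mem_ofPred_eq, heq]
  constructor
  · intro h v
    obtain ⟨-, e₀, -, hr⟩ := (C.exists_ratio v).choose_spec
    refine ⟨∏ w, z w ^ C.exponent v e₀ w, fun e => ?_⟩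
    obtain ⟨b, hb⟩ := hr e
    have h1 := congrArg (eval z) (hb fun e => monomial (C.exponent v e) 1)
    simp only [map_sub, map_mul, map_sum, eval_C, eval_monomial_one] at h1
    rw [Finset.sum_eq_zero (fun i _ => by rw [h ⟨v, i⟩, mul_zero]), sub_eq_zero] at h1
    exact h1
  · intro h j
    obtain ⟨hk, -⟩ := (C.exists_ratio j.1).choose_spec
    obtain ⟨s, hs⟩ := h j.1
    simp only [hs, ← mul_assoc, ← Finset.sum_mul]
    rw [show ∑ e, C.coeff j.1 j.2 e * (C.ratio j.1 e : ℂ) = 0 from hk j.2, zero_mul]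

end Ratio

section Coordinates

/-- If one coordinate of a point of the curve beyond `u` vanishes, all coordinates beyond `u`
vanish. -/
lemma eq_zero_of_below {z : D.Var → ℂ} (hz : z ∈ zeroLocus ℂ C.ideal) (u : V) (hu : u ≠ D.root)
    {w : D.Var} (hw : D.Below u w.1) (h0 : z w = 0) {w' : D.Var} (hw' : D.Below u w'.1) :
    z w' = 0 := by
  induction u using subtree_induction (D := D) generalizing w w' with
  | h u ih =>
    rcases valency_cases hu with h1 | h1
    · rw [below_leaf_iff hu h1] at hw hw'
      rwa [Subtype.ext (hw'.trans hw.symm)]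
    · let v : D.Node := ⟨u, h1⟩
      obtain ⟨s, hs⟩ := (C.mem_zeroLocus_iff z).1 hz v
      obtain ⟨e, he⟩ := Var.exists_outEdge v hw
      obtain ⟨e', he'⟩ := Var.exists_outEdge v hw'
      -- M_ve is not constant and all its variables vanish by induction, so the common factor `s` is
      -- zero. Then every M_ve' vanishes too, hence so does some variable beyond `e'`, and induction
      -- spreads this.
      have hs0 : s = 0 := by
        obtain ⟨x, hx⟩ := Finsupp.ne_iff.1 (C.exponent_ne_zero v e)
        have h2 := hs e
        rw [Finset.prod_eq_zero (Finset.mem_univ x)] at h2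
        · exact (mul_eq_zero.1 h2.symm).resolve_left (Units.ne_zero _)
        · rw [ih e e.ne_root he h0 (C.below_of_exponent_ne_zero v e hx), zero_pow hx]
      have h2 := hs e'
      rw [hs0, mul_zero, Finset.prod_eq_zero_iff] at h2
      obtain ⟨x, -, hx⟩ := h2
      have hx0 : C.exponent v e' x ≠ 0 := by
        intro h
        rw [h, pow_zero] at hx
        exact one_ne_zero hx
      exact ih e' e'.ne_root (C.below_of_exponent_ne_zero v e' hx0)
        (pow_eq_zero_iff hx0 |>.1 hx) he'

end Coordinates

lemma eq_zero_of_mem_zeroLocus {z : D.Var → ℂ} (hz : z ∈ zeroLocus ℂ C.ideal) {w : D.Var}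
    (h0 : z w = 0) (w' : D.Var) : z w' = 0 := by
  obtain ⟨u, -, hu⟩ := D.exists_top
  exact C.eq_zero_of_below hz u.1 u.ne_root (hu _ w.2.2) h0 (hu _ w'.2.2)

/-! ### The upper bound: monomials modulo the ideal. -/

section Generation

lemma linkingBelow_top {u : D.OutEdge D.root} (hu : ∀ e, e = u) (w : D.Var) :
    D.linkingBelow u.1 w = D.linking D.root w.1 := by
  obtain ⟨u', -, hu'⟩ := D.exists_top
  have h : D.Below u.1 w.1 := by rw [← hu u']; exact hu' _ w.2.2
  rw [linkingBelow_of_below h, linking_root u hu w h]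

lemma linking_root_pos (w : D.Var) : 0 < D.linking D.root w.1 := by
  obtain ⟨u, hu, hb⟩ := D.exists_top
  rw [← linkingBelow_top hu, linkingBelow_of_below (hb _ w.2.2)]
  exact linkingFrom_pos _ u.ne_root w (hb _ w.2.2)

lemma monomialCon_exponent (v : D.Node) (e e' : D.OutEdge v.1) :
    monomialCon C.ideal (fun w => D.linking D.root w.1) (C.exponent v e) (C.exponent v e') := by
  refine ⟨?_, _, C.mk_monomial_exponent v e e'⟩
  obtain ⟨u, hu, hb⟩ := D.exists_top
  obtain ⟨d, hd⟩ := C.exists_degree u.1 v (hb _ v.ne_root)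
  simp only [linkingBelow_top hu] at hd
  rw [hd, hd]

/-- At a node, division by M_ve leaves d_ve remainders beyond each edge other than the one towards
`w`, which are exactly the factors that the linking number gains. -/
lemma generatedBy_single (u : V) (hu : u ≠ D.root) (w : D.Var) (hw : w ∈ D.leavesBelow u) :
    GeneratedBy (monomialCon C.ideal fun w => D.linking D.root w.1) (D.leavesBelow u)
      (Finsupp.single w 1) (D.linkingBelow u w) := by
  classical
  induction u using subtree_induction (D := D) generalizing w with
  | h u ih =>
    rcases valency_cases hu with h1 | h1
    · obtain rfl := (below_leaf_iff hu h1).1 hw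
      rw [leavesBelow_leaf, linkingBelow_of_below hw, linkingFrom_leaf]
      exact GeneratedBy.singleton _ w
    · let v : D.Node := ⟨u, h1⟩
      obtain ⟨e₁, he₁⟩ := Var.exists_outEdge v hw
      rw [show D.leavesBelow u = _ from leavesBelow_node v, linkingBelow_outEdge e₁ he₁]
      refine GeneratedBy.iUnion (disjoint_leavesBelow u) (β := C.exponent v)
        (fun e w hw => C.below_of_exponent_ne_zero v e (by simpa using hw))
        (C.monomialCon_exponent v) (fun e => ?_) (ih e₁ e₁.ne_root w he₁)
      rw [show D.weight u e.1 = _ from (C.sum_exponent_mul v e).symm]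
      exact GeneratedBy.of_single linking_root_pos (fun m m' (h : _ ∧ _) => h.1) (ih e e.ne_root)
        (fun w hw => C.below_of_exponent_ne_zero v e (by simpa using hw)) (C.exponent_ne_zero v e)

end Generation

/-! ### The lower bound: points of the torus part. -/

section Counting

/-- The solutions in the torus of the equations at the nodes beyond `u`, with the coordinates
that belong to other leaves set to one. -/
def torusPoints (u : V) : Set (D.Var → ℂˣ) :=
  {z | (∀ w : D.Var, ¬ D.Below u w.1 → z w = 1) ∧ ∀ v : D.Node, D.Below u v.1 →
    ∃ s, ∀ e, ∏ w, z w ^ C.exponent v e w = C.ratio v e * s}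

lemma weightedScale_mem_torusPoints {u : V} (t : ℂˣ) {z : D.Var → ℂˣ}
    (hz : z ∈ C.torusPoints u) : weightedScale (D.linkingBelow u) t z ∈ C.torusPoints u := by
  refine ⟨fun w hw => ?_, fun v hv => ?_⟩
  · simp [weightedScale, linkingBelow_of_not_below hw, hz.1 w hw]
  · obtain ⟨d, hd⟩ := C.exists_degree u v hv
    obtain ⟨s, hs⟩ := hz.2 v hv
    refine ⟨t ^ d * s, fun e => ?_⟩
    have h1 := prod_weightedScale_zpow (D.linkingBelow u) t z fun w => (C.exponent v e w : ℤ)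
    have h2 : ∑ w, (C.exponent v e w : ℤ) * (D.linkingBelow u w : ℤ) = (d : ℤ) := by
      exact_mod_cast hd e
    simp only [h2, zpow_natCast, hs] at h1
    rw [h1]
    exact mul_left_comm _ _ _

open Classical in
/-- Set the coordinates that do not belong to leaves beyond `u` to one. -/
def restrictBelow (u : V) (z : D.Var → ℂˣ) : D.Var → ℂˣ :=
  fun w => if D.Below u w.1 then z w else 1

lemma restrictBelow_apply {u : V} (z : D.Var → ℂˣ) {w : D.Var} (h : D.Below u w.1) :
    restrictBelow u z w = z w := if_pos h

lemma restrictBelow_mem {v : V} (e : D.OutEdge v) {z : D.Var → ℂˣ}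
    (hz : z ∈ C.torusPoints v) : restrictBelow e.1 z ∈ C.torusPoints e.1 := by
  refine ⟨fun w hw => if_neg hw, fun x hx => ?_⟩
  obtain ⟨s, hs⟩ := hz.2 x (e.below.trans hx)
  refine ⟨s, fun e' => ?_⟩
  rw [← hs e']
  exact prod_pow_congr fun w hw => restrictBelow_apply z
    (hx.trans (e'.below.trans (C.below_of_exponent_ne_zero x e' hw)))

/-- With the coordinates outside each subtree normalised to 1, gluing the solutions beyond different
edges is multiplication. -/
lemma prod_apply_of_below {v : V} {y : D.OutEdge v → D.Var → ℂˣ}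
    (hy : ∀ e, y e ∈ C.torusPoints e.1) (e : D.OutEdge v) {w : D.Var} (h : D.Below e.1 w.1) :
    (∏ e', y e') w = y e w := by
  rw [Finset.prod_apply, Finset.prod_eq_single e]
  · intro e' _ hne
    exact (hy e').1 w fun h' => hne (OutEdge.eq_of_below h' h)
  · simp

lemma prod_mem_torusPoints (v : D.Node) {y : D.OutEdge v.1 → D.Var → ℂˣ}
    (hy : ∀ e, y e ∈ C.torusPoints e.1) {s : ℂˣ}
    (hs : ∀ e, ∏ w, y e w ^ C.exponent v e w = C.ratio v e * s) :
    ∏ e, y e ∈ C.torusPoints v.1 := by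
  refine ⟨fun w hw => ?_, fun x hx => ?_⟩
  · rw [Finset.prod_apply]
    exact Finset.prod_eq_one fun e _ => (hy e).1 w fun h => hw (e.below.trans h)
  · rcases hx.eq_or_exists with h | ⟨e, he⟩
    · obtain rfl : x = v := Subtype.ext h
      refine ⟨s, fun e => ?_⟩
      rw [← hs e]
      exact prod_pow_congr fun w hw =>
        C.prod_apply_of_below hy e (C.below_of_exponent_ne_zero x e hw)
    · obtain ⟨s', hs'⟩ := (hy e).2 x he
      refine ⟨s', fun e' => ?_⟩
      rw [← hs' e']
      exact prod_pow_congr fun w hw => C.prod_apply_of_below hy e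
        (he.trans (e'.below.trans (C.below_of_exponent_ne_zero x e' hw)))

lemma restrictBelow_prod {v : V} {y : D.OutEdge v → D.Var → ℂˣ}
    (hy : ∀ e, y e ∈ C.torusPoints e.1) (e : D.OutEdge v) :
    restrictBelow e.1 (∏ e', y e') = y e := by
  ext1 w
  by_cases h : D.Below e.1 w.1
  · rw [restrictBelow_apply _ h, C.prod_apply_of_below hy e h]
  · rw [(hy e).1 w h, restrictBelow, if_neg h]

lemma prod_restrictBelow (v : D.Node) {z : D.Var → ℂˣ} (hz : z ∈ C.torusPoints v.1) :
    ∏ e : D.OutEdge v.1, restrictBelow e.1 z = z := by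
  ext1 w
  by_cases h : D.Below v.1 w.1
  · obtain ⟨e, he⟩ := Var.exists_outEdge v h
    rw [C.prod_apply_of_below (fun e => C.restrictBelow_mem e hz) e he, restrictBelow_apply _ he]
  · rw [hz.1 w h, Finset.prod_apply]
    exact Finset.prod_eq_one fun e _ => if_neg fun h' => h (e.below.trans h')

open Classical in
/-- The family with the value `a` at `i₀` and the values `b` elsewhere. -/
def glue {ι A : Type*} (i₀ : ι) (a : A) (b : {i // i ≠ i₀} → A) (i : ι) : A :=
  if h : i = i₀ then a else b ⟨i, h⟩

lemma glue_self {ι A : Type*} (i₀ : ι) (a : A) (b : {i // i ≠ i₀} → A) : glue i₀ a b i₀ = a :=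
  dif_pos rfl

lemma glue_of_ne {ι A : Type*} (i₀ : ι) (a : A) (b : {i // i ≠ i₀} → A) (i : {i // i ≠ i₀}) :
    glue i₀ a b i.1 = b i :=
  dif_neg i.2

open Classical in
/-- A solution of the equations beyond the node `v` amounts to a solution beyond one of the
edges at `v`, and solutions beyond the other edges with prescribed values of the admissible
monomials at `v`. -/
def torusPointsEquiv (v : D.Node) (e₁ : D.OutEdge v.1) (w : D.Var) (hw : D.Below e₁.1 w.1)
    (b : ℂˣ) :
    {z ∈ C.torusPoints v.1 | z w = b} ≃
      Σ z : {z ∈ C.torusPoints e₁.1 | z w = b}, ∀ e : {e : D.OutEdge v.1 // e ≠ e₁},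
        {y ∈ C.torusPoints e.1.1 | ∏ w, y w ^ (C.exponent v e.1 w : ℤ) =
          C.ratio v e.1 * ((∏ w, z.1 w ^ C.exponent v e₁ w) / C.ratio v e₁)} := by
  have hprod : ∀ (e : D.OutEdge v.1) (z : D.Var → ℂˣ),
      ∏ w, restrictBelow e.1 z w ^ C.exponent v e w = ∏ w, z w ^ C.exponent v e w :=
    fun e z => prod_pow_congr fun w hw =>
      restrictBelow_apply z (C.below_of_exponent_ne_zero v e hw)
  have hmem : ∀ (p : Σ z : {z ∈ C.torusPoints e₁.1 | z w = b},
      ∀ e : {e : D.OutEdge v.1 // e ≠ e₁},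
        {y ∈ C.torusPoints e.1.1 | ∏ w, y w ^ (C.exponent v e.1 w : ℤ) =
          C.ratio v e.1 * ((∏ w, z.1 w ^ C.exponent v e₁ w) / C.ratio v e₁)}),
      ∀ e, glue e₁ p.1.1 (fun e => (p.2 e).1) e ∈ C.torusPoints e.1 := by
    intro p e
    by_cases he : e = e₁
    · subst he; rw [glue_self]; exact p.1.2.1
    · rw [glue_of_ne _ _ _ ⟨e, he⟩]; exact (p.2 ⟨e, he⟩).2.1
  exact
  { toFun := fun z => ⟨⟨restrictBelow e₁.1 z.1, C.restrictBelow_mem e₁ z.2.1,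
        (restrictBelow_apply _ hw).trans z.2.2⟩,
      fun e => ⟨restrictBelow e.1.1 z.1, C.restrictBelow_mem e.1 z.2.1, by
        obtain ⟨s, hs⟩ := z.2.1.2 v (Below.refl _)
        simp only [zpow_natCast, hprod, hs, mul_div_cancel_left]⟩⟩
    invFun := fun p => ⟨∏ e, glue e₁ p.1.1 (fun e => (p.2 e).1) e, by
        refine C.prod_mem_torusPoints v (hmem p)
          (s := (∏ w, p.1.1 w ^ C.exponent v e₁ w) / C.ratio v e₁) fun e => ?_
        by_cases he : e = e₁
        · subst he; rw [glue_self, mul_div_cancel]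
        · rw [glue_of_ne _ _ _ ⟨e, he⟩]
          simpa only [zpow_natCast] using (p.2 ⟨e, he⟩).2.2, by
        rw [C.prod_apply_of_below (hmem p) e₁ hw, glue_self]
        exact p.1.2.2⟩
    left_inv := fun z => by
      apply Subtype.ext
      refine Eq.trans (Finset.prod_congr rfl fun e _ => ?_) (C.prod_restrictBelow v z.2.1)
      by_cases he : e = e₁
      · subst he; exact glue_self _ _ _
      · exact glue_of_ne _ _ _ ⟨e, he⟩
    right_inv := fun p => by
      have h1 : restrictBelow e₁.1 (∏ e, glue e₁ p.1.1 (fun e => (p.2 e).1) e) = p.1.1 := by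
        rw [C.restrictBelow_prod (hmem p), glue_self]
      have h2 : ∀ e : {e : D.OutEdge v.1 // e ≠ e₁},
          restrictBelow e.1.1 (∏ e, glue e₁ p.1.1 (fun e => (p.2 e).1) e) = (p.2 e).1 := by
        intro e
        rw [C.restrictBelow_prod (hmem p), glue_of_ne]
      rcases p with ⟨⟨z, hz⟩, y⟩
      refine Sigma.ext (Subtype.ext h1) ?_
      refine Function.hfunext rfl fun e e' hee => ?_
      obtain rfl := eq_of_heq hee
      refine (Subtype.heq_iff_coe_eq fun s => ?_).2 (h2 e)
      rw [Set.mem_ofPred_eq, Set.mem_ofPred_eq]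
      simp only [h1] }

lemma ncard_torusPoints (u : V) (hu : u ≠ D.root) (w : D.Var) (hw : D.Below u w.1) (b : ℂˣ) :
    {z ∈ C.torusPoints u | z w = b}.ncard = D.linkingBelow u w := by
  classical
  induction u using subtree_induction (D := D) generalizing w b with
  | h u ih =>
    rcases valency_cases hu with h1 | h1
    · obtain rfl := (below_leaf_iff hu h1).1 hw
      rw [linkingBelow_of_below hw, linkingFrom_leaf, Set.ncard_eq_one]
      refine ⟨Function.update 1 w b, Set.eq_singleton_iff_unique_mem.2 ⟨⟨⟨fun x hx => ?_,
        fun v hv => ?_⟩, Function.update_self _ _ _⟩, fun z hz => ?_⟩⟩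
      · rw [Function.update_of_ne]
        · rfl
        · rintro rfl; exact hx (Below.refl _)
      · have h2 := v.2
        rw [(below_leaf_iff hu h1).1 hv] at h2
        omega
      · ext1 x
        by_cases hx : x = w
        · subst hx; rw [Function.update_self, hz.2]
        · rw [Function.update_of_ne hx]
          exact hz.1.1 x fun h => hx (Subtype.ext ((below_leaf_iff hu h1).1 h))
    · let v : D.Node := ⟨u, h1⟩
      obtain ⟨e₁, he₁⟩ := Var.exists_outEdge v hw
      -- The induction hypothesis at one leaf beyond `e` fixes the size of every slice there; the
      -- slice of M_ve has as many points as the weight of M_ve, namely d_ve.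
      have hslice : ∀ (e : D.OutEdge u) (b : ℂˣ),
          Nat.card {y ∈ C.torusPoints e.1 | ∏ w, y w ^ (C.exponent v e w : ℤ) = b} =
            D.weight u e.1 := by
        intro e b
        obtain ⟨x, hx⟩ := exists_leaf_below e.1 e.ne_root
        rw [Nat.card_coe_set_eq]
        refine ncard_slice (l := D.linkingBelow e.1)
          (fun t z hz => C.weightedScale_mem_torusPoints t hz) (w₀ := x) ?_
          (ih e e.ne_root x hx 1) _ (weight_outEdge_pos v e) ?_ b
        · rw [linkingBelow_of_below hx]
          exact linkingFrom_pos _ e.ne_root x hx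
        · exact_mod_cast C.sum_exponent_mul v e
      have h2 := ih e₁ e₁.ne_root w he₁ b
      rw [← Nat.card_coe_set_eq] at h2
      have : Finite {z ∈ C.torusPoints e₁.1 | z w = b} := by
        refine Nat.finite_of_card_ne_zero ?_
        rw [h2, linkingBelow_of_below he₁]
        exact (linkingFrom_pos _ e₁.ne_root w he₁).ne'
      rw [← Nat.card_coe_set_eq, Nat.card_congr (C.torusPointsEquiv v e₁ w he₁ b),
        card_sigma_const (N := ∏ e ∈ Finset.univ.erase e₁, D.weight u e.1), h2,
        linkingBelow_outEdge e₁ he₁, mul_comm]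
      · exact Finset.prod_pos fun e _ => weight_outEdge_pos v e
      · intro z
        rw [Nat.card_pi, Finset.prod_congr rfl fun e _ => hslice e.1 _]
        exact (Finset.prod_subtype (Finset.univ.erase e₁) (by simp)
          fun e : D.OutEdge u => D.weight u e.1).symm

end Counting

end CurveData

end RootedSpliceDiagram

/-! ### Curves whose points are the origin and finitely many ℂˣ-orbits. -/

/-- The closed subscheme of affine space defined by `I` has no points besides the origin and the
points of `X`, which is stable under an action of `ℂˣ` with coprime positive weights `n`; the
slices `z_w = b` of `X` have `g * n w` points, and modulo `I` and nonzero factors every monomial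
is the product of a power of `z_w` and one of at most `g * n w` monomials. -/
structure IsTorusCurve {σ : Type*} [Fintype σ] (I : Ideal (MvPolynomial σ ℂ)) (g : ℕ) (n : σ → ℕ)
    (u : σ → ℤ) (X : Set (σ → ℂˣ)) : Prop where
  pos : 0 < g
  weight_pos : ∀ w, 0 < n w
  bezout : ∑ w, u w * n w = 1
  mem_zeroLocus : ∀ z ∈ X, (fun w => (z w : ℂ)) ∈ zeroLocus ℂ I
  exists_of_ne_zero : ∀ z ∈ zeroLocus ℂ I, z ≠ 0 → ∃ x ∈ X, z = fun w => (x w : ℂ)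
  scale_mem : ∀ t, ∀ z ∈ X, weightedScale n t z ∈ X
  ncard_fiber : ∀ w b, {z ∈ X | z w = b}.ncard = g * n w
  generated : ∀ w, ∃ B : Finset (σ →₀ ℕ), B.card ≤ g * n w ∧ ∀ m, ∃ i : ℕ, ∃ b ∈ B, ∃ c : ℂ,
    Ideal.Quotient.mk I (monomial m 1) =
      Ideal.Quotient.mk I (monomial (i • Finsupp.single w 1 + b) c)

lemma exists_coprime_weights {σ : Type*} [Fintype σ] [Nonempty σ] {l : σ → ℕ}
    (hl : ∀ w, 0 < l w) : 0 < Finset.univ.gcd l ∧ ∃ n : σ → ℕ, (∀ w, 0 < n w) ∧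
      (∀ w, l w = Finset.univ.gcd l * n w) ∧ ∃ u : σ → ℤ, ∑ w, u w * n w = 1 := by
  set g := Finset.univ.gcd l with hg
  have hdvd : ∀ w, g ∣ l w := fun w => Finset.gcd_dvd (Finset.mem_univ w)
  obtain ⟨w₀⟩ := ‹Nonempty σ›
  have hgpos : 0 < g := Nat.pos_of_dvd_of_pos (hdvd w₀) (hl w₀)
  choose n hn using hdvd
  refine ⟨hgpos, n, fun w => Nat.pos_of_mul_pos_left (hn w ▸ hl w), hn, ?_⟩
  obtain ⟨u, hu⟩ := Finset.gcd_eq_sum_mul Finset.univ fun w => (n w : ℤ)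
  set G : ℤ := Finset.univ.gcd fun w => (n w : ℤ) with hG
  have hGn : ∀ w, G ∣ n w := fun w => Finset.gcd_dvd (Finset.mem_univ w)
  -- A common divisor of the quotients `n w`, multiplied by `g`, still divides every `l w`; hence
  -- the quotients are coprime.
  have h1 : g * G.natAbs ∣ g := by
    rw [hg]
    refine Finset.dvd_gcd fun w _ => ?_
    rw [← hg, hn w]
    exact Nat.mul_dvd_mul_left g (Int.natAbs_dvd_natAbs.2 (hGn w) |>.trans (by simp))
  have h2 : G.natAbs = 1 := by
    have h3 := Nat.le_of_dvd hgpos h1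
    have h4 : G.natAbs ≠ 0 := by
      intro h
      rw [h, mul_zero] at h1
      exact hgpos.ne' (Nat.eq_zero_of_zero_dvd h1)
    have h5 : g * G.natAbs ≤ g * 1 := by simpa using h3
    have h6 := Nat.le_of_mul_le_mul_left h5 hgpos
    omega
  rcases Int.natAbs_eq G with h | h
  · refine ⟨u, ?_⟩
    rw [h2, hu] at h
    rw [← Nat.cast_one, ← h]
    exact Finset.sum_congr rfl fun w _ => mul_comm _ _
  · refine ⟨-u, ?_⟩
    rw [h2, hu, eq_neg_iff_add_eq_zero] at h
    simp only [Pi.neg_apply, neg_mul, Finset.sum_neg_distrib]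
    rw [neg_eq_iff_add_eq_zero, ← Nat.cast_one, ← h]
    congr 1
    exact Finset.sum_congr rfl fun w _ => mul_comm _ _

namespace IsTorusCurve

/-- Every polynomial is, modulo `I`, a combination of the given monomials with coefficients that
are polynomials in `z_w`. -/
lemma exists_coeff {σ : Type*} {I : Ideal (MvPolynomial σ ℂ)} {w : σ} {B : Finset (σ →₀ ℕ)}
    (hB : ∀ m, ∃ i : ℕ, ∃ b ∈ B, ∃ c : ℂ, Ideal.Quotient.mk I (monomial m 1) =
      Ideal.Quotient.mk I (monomial (i • Finsupp.single w 1 + b) c))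
    (f : MvPolynomial σ ℂ) : ∃ q : (σ →₀ ℕ) → Polynomial ℂ, Ideal.Quotient.mk I f =
      Ideal.Quotient.mk I (∑ b ∈ B, Polynomial.aeval (MvPolynomial.X w) (q b) * monomial b 1) := by
  classical
  induction f using MvPolynomial.induction_on' with
  | monomial m a =>
    obtain ⟨i, b, hb, c, h⟩ := hB m
    refine ⟨Pi.single b (Polynomial.C (a * c) * Polynomial.X ^ i), ?_⟩
    rw [Finset.sum_eq_single b]
    · have h1 : monomial m a = C a * monomial m 1 := by rw [C_mul_monomial, mul_one]
      have h2 : Polynomial.aeval (MvPolynomial.X w : MvPolynomial σ ℂ)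
          (Polynomial.C (a * c) * Polynomial.X ^ i) * monomial b 1 =
          C a * monomial (i • Finsupp.single w 1 + b) c := by
        rw [map_mul, Polynomial.aeval_C, map_pow, Polynomial.aeval_X, X_pow_eq_monomial,
          algebraMap_eq, map_mul C, mul_assoc, mul_assoc, monomial_mul, C_mul_monomial]
        simp
      rw [Pi.single_eq_same, h2, h1, map_mul, h, map_mul]
    · intro b' _ hne
      rw [Pi.single_eq_of_ne hne, map_zero, zero_mul]
    · exact fun h => (h hb).elim
  | add p q hp hq =>
    obtain ⟨P, hP⟩ := hp
    obtain ⟨Q, hQ⟩ := hq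
    refine ⟨P + Q, ?_⟩
    rw [map_add, hP, hQ, ← map_add, ← Finset.sum_add_distrib]
    simp only [Pi.add_apply, map_add, add_mul]

/-- The parametrization `t ↦ (e_w t ^ n_w)` of the closure of the orbit of `e`. -/
def param {σ : Type*} (n : σ → ℕ) (e : σ → ℂˣ) : MvPolynomial σ ℂ →ₐ[ℂ] Polynomial ℂ :=
  aeval fun w => Polynomial.C (e w : ℂ) * Polynomial.X ^ n w

lemma eval_param {σ : Type*} {n : σ → ℕ} (e : σ → ℂˣ) (f : MvPolynomial σ ℂ) (t : ℂ) :
    (param n e f).eval t = eval (fun w => (e w : ℂ) * t ^ n w) f := by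
  have : (Polynomial.aeval t).comp (param n e) = aeval fun w => (e w : ℂ) * t ^ n w := by
    ext w
    simp [param]
  have h1 := DFunLike.congr_fun this f
  rw [AlgHom.comp_apply, Polynomial.coe_aeval_eq_eval] at h1
  rw [h1]
  rfl

lemma eval_param_unit {σ : Type*} {n : σ → ℕ} (e : σ → ℂˣ) (f : MvPolynomial σ ℂ) (t : ℂˣ) :
    (param n e f).eval (t : ℂ) = eval (fun w => (weightedScale n t e w : ℂ)) f := by
  rw [eval_param]
  congr 2
  ext w
  rw [weightedScale, Units.val_mul, Units.val_pow_eq_pow_val, mul_comm]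

lemma param_eq_zero_iff {σ : Type*} {n : σ → ℕ} (e : σ → ℂˣ) (f : MvPolynomial σ ℂ) :
    param n e f = 0 ↔ ∀ t, eval (fun w => (weightedScale n t e w : ℂ)) f = 0 := by
  constructor
  · intro h t
    rw [← eval_param_unit, h, Polynomial.eval_zero]
  · intro h
    -- Only nonzero parameters belong to the orbit; the factor `X` takes care of the value at 0.
    have : Polynomial.X * param n e f = 0 := by
      refine Polynomial.funext fun y => ?_
      rw [Polynomial.eval_mul, Polynomial.eval_X, Polynomial.eval_zero]
      by_cases hy : y = 0
      · rw [hy, zero_mul]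
      · rw [show y = (Units.mk0 y hy : ℂˣ) from rfl, eval_param_unit, h, mul_zero]
    exact (mul_eq_zero.1 this).resolve_left Polynomial.X_ne_zero

variable {σ : Type*} [Fintype σ] {I : Ideal (MvPolynomial σ ℂ)} {g : ℕ} {n : σ → ℕ} {u : σ → ℤ}
  {X : Set (σ → ℂˣ)}

/-! ### The two bounds meet: the ideal is radical. -/

section Radical

lemma eval_eq_of_mk_eq (h : IsTorusCurve I g n u X) {f f' : MvPolynomial σ ℂ}
    (hf : Ideal.Quotient.mk I f = Ideal.Quotient.mk I f') {z : σ → ℂˣ} (hz : z ∈ X) :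
    eval (fun w => (z w : ℂ)) f = eval (fun w => (z w : ℂ)) f' := by
  have h1 := h.mem_zeroLocus z hz _ (Ideal.Quotient.eq.1 hf)
  rw [map_sub, sub_eq_zero] at h1
  exact h1

/-- The values at the points of a slice are independent on the generating monomials. -/
lemma linearIndependent_eval (h : IsTorusCurve I g n u X) {w : σ} {B : Finset (σ →₀ ℕ)}
    (hB : ∀ m, ∃ i : ℕ, ∃ b ∈ B, ∃ c : ℂ, Ideal.Quotient.mk I (monomial m 1) =
      Ideal.Quotient.mk I (monomial (i • Finsupp.single w 1 + b) c)) (y : ℂˣ) :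
    LinearIndependent ℂ fun (p : {z ∈ X | z w = y}) (b : B) =>
      eval (fun w => (p.1 w : ℂ)) (monomial b.1 1) := by
  -- Distinct points are distinct characters of the monoid of monomials, so they are linearly
  -- independent as functions on all monomials.
  let χ : {z ∈ X | z w = y} → (Multiplicative (σ →₀ ℕ) →* ℂ) := fun p =>
    { toFun := fun m => eval (fun w => (p.1 w : ℂ)) (monomial m.toAdd 1)
      map_one' := by simp
      map_mul' := fun a b => by
        rw [toAdd_mul, ← map_mul, monomial_mul, mul_one] }
  have hχ : Function.Injective χ := by
    intro p p' hpp
    apply Subtype.ext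
    ext w
    have h1 := DFunLike.congr_fun hpp (Multiplicative.ofAdd (Finsupp.single w 1))
    change eval _ (MvPolynomial.X w) = eval _ (MvPolynomial.X w) at h1
    rwa [eval_X, eval_X] at h1
  have hli := (linearIndependent_monoidHom (Multiplicative (σ →₀ ℕ)) ℂ).comp χ hχ
  rw [linearIndependent_iff'] at hli ⊢
  intro s a ha p hp
  refine hli s a ?_ p hp
  ext m
  obtain ⟨i, b, hb, c, hm⟩ := hB m.toAdd
  -- On the slice the factor relating `m` to a generator is the same at all points, so a linear
  -- relation on the generators extends to all monomials.
  have h1 : ∀ p : {z ∈ X | z w = y}, χ p m =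
      (c * y ^ i) * eval (fun w => (p.1 w : ℂ)) (monomial b 1) := by
    intro p
    have h2 : monomial (i • Finsupp.single w 1 + b) c =
        C c * (MvPolynomial.X w ^ i * monomial b 1) := by
      rw [X_pow_eq_monomial, monomial_mul, C_mul_monomial]
      simp
    have h3 := h.eval_eq_of_mk_eq hm p.2.1
    rw [h2, map_mul, map_mul, map_pow, eval_X, eval_C, p.2.2, ← mul_assoc] at h3
    exact h3
  have h2 := congrFun ha ⟨b, hb⟩
  simp only [Finset.sum_apply, Pi.smul_apply, smul_eq_mul, Pi.zero_apply] at h2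
  simp only [Function.comp_apply, Finset.sum_apply, Pi.smul_apply, smul_eq_mul, Pi.zero_apply, h1]
  rw [← mul_zero (c * (y : ℂ) ^ i), ← h2, Finset.mul_sum]
  exact Finset.sum_congr rfl fun p _ => mul_left_comm _ _ _

lemma finite_slice (h : IsTorusCurve I g n u X) (w : σ) (y : ℂˣ) : {z ∈ X | z w = y}.Finite :=
  Set.finite_of_ncard_ne_zero
    (by rw [h.ncard_fiber]; exact (Nat.mul_pos h.pos (h.weight_pos w)).ne')

lemma nonempty_index (h : IsTorusCurve I g n u X) : Nonempty σ := by
  by_contra h0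
  rw [not_nonempty_iff] at h0
  simpa using h.bezout

/-- A polynomial that vanishes on `X` belongs to `I`. -/
lemma mem_of_eval_eq_zero (h : IsTorusCurve I g n u X) {f : MvPolynomial σ ℂ}
    (hf : ∀ z ∈ X, eval (fun w => (z w : ℂ)) f = 0) : f ∈ I := by
  obtain ⟨w⟩ := h.nonempty_index
  obtain ⟨B, hBc, hB⟩ := h.generated w
  obtain ⟨q, hq⟩ := exists_coeff hB f
  have key : ∀ y : ℂˣ, ∀ b ∈ B, (q b).eval (y : ℂ) = 0 := by
    intro y
    have hli := h.linearIndependent_eval hB y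
    have := (h.finite_slice w y).fintype
    have hcard : Fintype.card {z ∈ X | z w = y} = g * n w := by
      rw [← h.ncard_fiber w y, ← Nat.card_coe_set_eq, Nat.card_eq_fintype_card]
    have hle := hli.fintype_card_le_finrank
    rw [Module.finrank_fintype_fun_eq_card, Fintype.card_coe] at hle
    -- These are g · n_w independent vectors in a space of dimension at most g · n_w.
    have hspan := hli.span_eq_top_of_card_eq_finrank' (by
      rw [Module.finrank_fintype_fun_eq_card, Fintype.card_coe]; omega)
    -- Applied to the generator values at a point of the slice, this functional gives the value of
    -- `f` there.
    let φ : (B → ℂ) →ₗ[ℂ] ℂ := Fintype.linearCombination ℂ fun b : B => (q b).eval (y : ℂ)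
    have hφ : φ = 0 := by
      refine LinearMap.ext_on_range hspan fun p => ?_
      have h1 := h.eval_eq_of_mk_eq hq p.2.1
      rw [hf _ p.2.1, map_sum, ← Finset.sum_coe_sort] at h1
      rw [LinearMap.zero_apply, Fintype.linearCombination_apply, h1]
      refine Finset.sum_congr rfl fun b _ => ?_
      rw [map_mul, smul_eq_mul, mul_comm]
      congr 1
      have h2 : (aeval fun w => (p.1 w : ℂ) : MvPolynomial σ ℂ →ₐ[ℂ] ℂ)
          (Polynomial.aeval (MvPolynomial.X w) (q b.1)) =
          (q b.1).eval (y : ℂ) := by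
        rw [← Polynomial.aeval_algHom_apply, aeval_X, p.2.2, Polynomial.coe_aeval_eq_eval]
      exact h2.symm
    intro b hb
    have h2 := LinearMap.congr_fun hφ (Pi.single ⟨b, hb⟩ 1)
    simpa [φ, Fintype.linearCombination_apply_single] using h2
  have hzero : ∀ b ∈ B, q b = 0 := by
    intro b hb
    have : Polynomial.X * q b = 0 := by
      refine Polynomial.funext fun y => ?_
      rw [Polynomial.eval_mul, Polynomial.eval_X, Polynomial.eval_zero]
      by_cases hy : y = 0
      · rw [hy, zero_mul]
      · rw [show y = (Units.mk0 y hy : ℂˣ) from rfl, key _ b hb, mul_zero]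
    exact (mul_eq_zero.1 this).resolve_left Polynomial.X_ne_zero
  rw [← Ideal.Quotient.eq_zero_iff_mem, hq, Finset.sum_eq_zero, map_zero]
  intro b hb
  rw [hzero b hb, map_zero, zero_mul]

lemma mem_iff (h : IsTorusCurve I g n u X) {f : MvPolynomial σ ℂ} :
    f ∈ I ↔ ∀ z ∈ X, eval (fun w => (z w : ℂ)) f = 0 :=
  ⟨fun hf z hz => h.mem_zeroLocus z hz f hf, h.mem_of_eval_eq_zero⟩

lemma isReduced (h : IsTorusCurve I g n u X) : IsReduced (MvPolynomial σ ℂ ⧸ I) := by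
  rw [← Ideal.isRadical_iff_quotient_reduced]
  rintro f ⟨k, hk⟩
  rw [h.mem_iff] at hk ⊢
  intro z hz
  have := hk z hz
  rw [map_pow] at this
  exact eq_zero_of_pow_eq_zero this

end Radical

/-! ### Representatives and equations of the orbits. -/

section Orbits

/-- The points of `X` that represent the orbits of `ℂˣ`. -/
def orbitReps (u : σ → ℤ) (X : Set (σ → ℂˣ)) : Set (σ → ℂˣ) := {z ∈ X | ∏ w, z w ^ u w = 1}

/-- The fibres have g · n_w points, while the weights are n_w. Letting t act through t^g makes the
weights fit `ncard_slice`. -/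
lemma ncard_prod_zpow (h : IsTorusCurve I g n u X) {α : σ → ℤ} {N : ℕ} (hN : 0 < N)
    (hα : ∑ w, α w * (g * n w : ℕ) = N) (b : ℂˣ) : {z ∈ X | ∏ w, z w ^ α w = b}.ncard = N := by
  obtain ⟨w⟩ := h.nonempty_index
  refine ncard_slice (l := fun w => g * n w) (fun t z hz => ?_) (w₀ := w)
    (Nat.mul_pos h.pos (h.weight_pos w)) (h.ncard_fiber w 1) α hN hα b
  have h1 := h.scale_mem (t ^ g) z hz
  have h2 : weightedScale n (t ^ g) z = weightedScale (fun w => g * n w) t z := by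
    ext w; simp [weightedScale, pow_mul]
  rwa [h2] at h1

lemma ncard_orbitReps (h : IsTorusCurve I g n u X) : (orbitReps u X).ncard = g := by
  refine h.ncard_prod_zpow h.pos ?_ 1
  have h1 := congrArg ((g : ℤ) * ·) h.bezout
  simp only [Finset.mul_sum, mul_one] at h1
  rw [← h1]
  refine Finset.sum_congr rfl fun w _ => ?_
  push_cast
  ring

lemma finite_orbitReps (h : IsTorusCurve I g n u X) : (orbitReps u X).Finite :=
  Set.finite_of_ncard_ne_zero (by rw [h.ncard_orbitReps]; exact h.pos.ne')

lemma prod_zpow_weightedScale (h : IsTorusCurve I g n u X) (t : ℂˣ) (z : σ → ℂˣ) :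
    ∏ w, weightedScale n t z w ^ u w = t * ∏ w, z w ^ u w := by
  rw [prod_weightedScale_zpow, h.bezout, zpow_one]

/-- By Bézout z^u is multiplied by t under the action of t, so it can be scaled to 1 in exactly one
way. -/
lemma exists_orbitRep (h : IsTorusCurve I g n u X) {z : σ → ℂˣ} (hz : z ∈ X) :
    ∃ e ∈ orbitReps u X, ∃ t, z = weightedScale n t e :=
  ⟨weightedScale n (∏ w, z w ^ u w)⁻¹ z,
    ⟨h.scale_mem _ z hz, by rw [h.prod_zpow_weightedScale, inv_mul_cancel]⟩, _,
    (weightedScale_inv_cancel n _ z).symm⟩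

/-- The monomial in which only the positive exponents of `u` are kept. -/
def posPart (u : σ → ℤ) : MvPolynomial σ ℂ := ∏ w, MvPolynomial.X w ^ (u w).toNat

lemma eval_posPart_ne_zero (u : σ → ℤ) (z : σ → ℂˣ) :
    eval (fun w => (z w : ℂ)) (posPart u) ≠ 0 := by
  simp only [posPart, map_prod, map_pow, eval_X]
  exact Finset.prod_ne_zero_iff.2 fun w _ => pow_ne_zero _ (Units.ne_zero _)

lemma eval_posPart (u : σ → ℤ) (z : σ → ℂˣ) : eval (fun w => (z w : ℂ)) (posPart u) =
    (∏ w, z w ^ u w : ℂˣ) * eval (fun w => (z w : ℂ)) (posPart (-u)) := by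
  simp only [posPart, map_prod, map_pow, eval_X, Pi.neg_apply, Units.coe_prod]
  rw [← Finset.prod_mul_distrib]
  refine Finset.prod_congr rfl fun w _ => ?_
  rw [Units.val_zpow_eq_zpow_val, ← zpow_natCast, ← zpow_natCast, ← zpow_add₀ (Units.ne_zero _)]
  congr 1
  omega

/-- The equations of the closure of the orbit of `e`, in the torus. -/
def orbitEquation (n : σ → ℕ) (u : σ → ℤ) (e : σ → ℂˣ) (w : σ) : MvPolynomial σ ℂ :=
  MvPolynomial.X w * posPart (-u) ^ n w - C (e w : ℂ) * posPart u ^ n w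

lemma eval_orbitEquation_eq_zero_iff (e z : σ → ℂˣ) (w : σ) :
    eval (fun w => (z w : ℂ)) (orbitEquation n u e w) = 0 ↔
      z w = weightedScale n (∏ w, z w ^ u w) e w := by
  rw [orbitEquation, map_sub, map_mul, map_mul, map_pow, map_pow, eval_X, eval_C, eval_posPart u,
    mul_pow, ← mul_assoc, ← sub_mul, mul_eq_zero,
    or_iff_left (pow_ne_zero _ (eval_posPart_ne_zero _ _)), sub_eq_zero, weightedScale,
    Units.ext_iff, Units.val_mul, Units.val_pow_eq_pow_val, mul_comm]

lemma eval_orbitEquation (h : IsTorusCurve I g n u X) {e : σ → ℂˣ} (he : e ∈ orbitReps u X)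
    (t : ℂˣ) (w : σ) :
    eval (fun w => (weightedScale n t e w : ℂ)) (orbitEquation n u e w) = 0 := by
  rw [eval_orbitEquation_eq_zero_iff, h.prod_zpow_weightedScale, he.2, mul_one]

lemma exists_orbitEquation_ne_zero (h : IsTorusCurve I g n u X) {e e' : σ → ℂˣ}
    (he : e ∈ orbitReps u X) (hne : e' ≠ e) (t : ℂˣ) :
    ∃ w, eval (fun w => (weightedScale n t e w : ℂ)) (orbitEquation n u e' w) ≠ 0 := by
  by_contra! hall
  apply hne
  have h1 : weightedScale n t e = weightedScale n t e' := by
    ext1 w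
    have h2 := (eval_orbitEquation_eq_zero_iff _ _ w).1 (hall w)
    rwa [h.prod_zpow_weightedScale, he.2, mul_one] at h2
  rw [← weightedScale_cancel_inv n t e', ← h1, weightedScale_cancel_inv]

end Orbits

/-! ### Orbit closures as the irreducible components. -/

section Parametrization

lemma param_eq_zero_of_mem (h : IsTorusCurve I g n u X) {e : σ → ℂˣ} (he : e ∈ X)
    {f : MvPolynomial σ ℂ} (hf : f ∈ I) : param n e f = 0 :=
  (param_eq_zero_iff e f).2 fun t => h.mem_zeroLocus _ (h.scale_mem t e he) f hf

lemma mem_iff_param (h : IsTorusCurve I g n u X) {f : MvPolynomial σ ℂ} :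
    f ∈ I ↔ ∀ e ∈ orbitReps u X, param n e f = 0 := by
  refine ⟨fun hf e he => h.param_eq_zero_of_mem he.1 hf, fun hf => h.mem_of_eval_eq_zero ?_⟩
  intro z hz
  obtain ⟨e, he, t, rfl⟩ := h.exists_orbitRep hz
  exact (param_eq_zero_iff e f).1 (hf e he) t

/-- The prime ideal of the closure of the orbit of `e`, in the coordinate ring. -/
def orbitIdeal (I : Ideal (MvPolynomial σ ℂ)) (n : σ → ℕ) (e : σ → ℂˣ) :
    Ideal (MvPolynomial σ ℂ ⧸ I) :=
  (RingHom.ker (param n e)).map (Ideal.Quotient.mk I)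

lemma mk_mem_orbitIdeal (h : IsTorusCurve I g n u X) {e : σ → ℂˣ} (he : e ∈ X)
    {f : MvPolynomial σ ℂ} :
    Ideal.Quotient.mk I f ∈ orbitIdeal I n e ↔ param n e f = 0 := by
  rw [orbitIdeal, Ideal.mem_map_iff_of_surjective _ Ideal.Quotient.mk_surjective]
  constructor
  · rintro ⟨f', hf', heq⟩
    have h1 := h.param_eq_zero_of_mem he (Ideal.Quotient.eq.1 heq)
    rw [map_sub, (RingHom.mem_ker).1 hf', zero_sub, neg_eq_zero] at h1
    exact h1
  · exact fun hf => ⟨f, hf, rfl⟩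

/-- The coordinate ring of the closure of the orbit of `e` is a ring of polynomials in one
variable. -/
def quotientOrbitIdealEquiv (h : IsTorusCurve I g n u X) {e : σ → ℂˣ} (he : e ∈ X) :
    ((MvPolynomial σ ℂ ⧸ I) ⧸ orbitIdeal I n e) ≃ₐ[ℂ] (param n e).range :=
  (DoubleQuot.quotQuotEquivQuotOfLEₐ ℂ (fun _ hf => h.param_eq_zero_of_mem he hf :
      I ≤ RingHom.ker (param n e))).trans
    ((Ideal.quotientEquivAlgOfEq ℂ (by
      ext f; rw [RingHom.mem_ker, RingHom.mem_ker, Subtype.ext_iff]; rfl :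
      RingHom.ker (param n e) = RingHom.ker (param n e).rangeRestrict)).trans
      (Ideal.quotientKerAlgEquivOfSurjective (param n e).rangeRestrict_surjective))

lemma range_param (e : σ → ℂˣ) : (param n e).range =
    Algebra.adjoin ℂ {q : Polynomial ℂ | ∃ k ∈ Finset.univ.image n, q = Polynomial.X ^ k} := by
  rw [param, ← Algebra.adjoin_range_eq_range_aeval]
  apply le_antisymm
  · refine Algebra.adjoin_le ?_
    rintro _ ⟨w, rfl⟩
    simp only [← Polynomial.smul_eq_C_mul]
    exact Subalgebra.smul_mem _ (Algebra.subset_adjoin (Set.mem_ofPred.2 ⟨n w, by simp, rfl⟩)) _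
  · refine Algebra.adjoin_le ?_
    rintro _ ⟨k, hk, rfl⟩
    obtain ⟨w, -, rfl⟩ := Finset.mem_image.1 hk
    have h1 := Subalgebra.smul_mem _ (Algebra.subset_adjoin (R := ℂ) (Set.mem_range_self
      (f := fun w => Polynomial.C (e w : ℂ) * Polynomial.X ^ n w) w)) ((e w)⁻¹ : ℂ)
    simpa [← Polynomial.smul_eq_C_mul, smul_smul] using h1

lemma isMonomialCurveRing (h : IsTorusCurve I g n u X) {e : σ → ℂˣ} (he : e ∈ X) :
    IsMonomialCurveRing ((MvPolynomial σ ℂ ⧸ I) ⧸ orbitIdeal I n e) := by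
  refine ⟨Finset.univ.image n, ?_, ?_, ⟨(h.quotientOrbitIdealEquiv he).trans
    (Subalgebra.equivOfEq _ _ (range_param e))⟩⟩
  · intro k hk
    obtain ⟨w, -, rfl⟩ := Finset.mem_image.1 hk
    exact h.weight_pos w
  · have h1 : ∀ w, (((Finset.univ.image n).gcd id : ℕ) : ℤ) ∣ n w := fun w =>
      Int.natCast_dvd_natCast.2 (Finset.gcd_dvd (f := id)
        (Finset.mem_image_of_mem n (Finset.mem_univ w)))
    have h2 := Finset.dvd_sum (s := Finset.univ) fun w _ => Dvd.dvd.mul_left (h1 w) (u w)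
    rw [h.bezout] at h2
    exact Nat.dvd_one.1 (by exact_mod_cast h2)

lemma isPrime_orbitIdeal (h : IsTorusCurve I g n u X) {e : σ → ℂˣ} (he : e ∈ X) :
    (orbitIdeal I n e).IsPrime := by
  rw [← Ideal.Quotient.isDomain_iff_prime]
  exact (h.quotientOrbitIdealEquiv he).toMulEquiv.isDomain _

lemma eq_of_orbitIdeal_le (h : IsTorusCurve I g n u X) {e e' : σ → ℂˣ}
    (he : e ∈ orbitReps u X) (he' : e' ∈ orbitReps u X)
    (hle : orbitIdeal I n e ≤ orbitIdeal I n e') : e = e' := by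
  by_contra hne
  obtain ⟨w, hw⟩ := h.exists_orbitEquation_ne_zero he' hne 1
  apply hw
  have h1 := hle ((h.mk_mem_orbitIdeal he.1).2 ((param_eq_zero_iff e (orbitEquation n u e w)).2
    fun t => h.eval_orbitEquation he t w))
  exact (param_eq_zero_iff _ _).1 ((h.mk_mem_orbitIdeal he'.1).1 h1) 1

/-- The ideals of the finitely many orbit closures intersect in zero, so a prime ideal contains one
of them. -/
lemma exists_orbitIdeal_le (h : IsTorusCurve I g n u X) (p : Ideal (MvPolynomial σ ℂ ⧸ I))
    [p.IsPrime] : ∃ e ∈ orbitReps u X, orbitIdeal I n e ≤ p := by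
  have h1 : h.finite_orbitReps.toFinset.inf (orbitIdeal I n) ≤ p := by
    intro x hx
    obtain ⟨f, rfl⟩ := Ideal.Quotient.mk_surjective x
    have h2 : f ∈ I := h.mem_iff_param.2 fun e he =>
      (h.mk_mem_orbitIdeal he.1).1 ((Submodule.mem_finsetInf.1 hx) e (by simpa using he))
    rw [Ideal.Quotient.eq_zero_iff_mem.2 h2]
    exact p.zero_mem
  obtain ⟨e, he, hle⟩ := (Ideal.IsPrime.inf_le' ‹_›).1 h1
  exact ⟨e, by simpa using he, hle⟩

lemma minimalPrimes_eq (h : IsTorusCurve I g n u X) :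
    minimalPrimes (MvPolynomial σ ℂ ⧸ I) = orbitIdeal I n '' orbitReps u X := by
  ext p
  constructor
  · intro hp
    have := hp.1.1
    obtain ⟨e, he, hle⟩ := h.exists_orbitIdeal_le p
    exact ⟨e, he, le_antisymm hle (hp.2 ⟨h.isPrime_orbitIdeal he.1, bot_le⟩ hle)⟩
  · rintro ⟨e, he, rfl⟩
    refine ⟨⟨h.isPrime_orbitIdeal he.1, bot_le⟩, ?_⟩
    rintro q ⟨hq, -⟩ hle
    obtain ⟨e', he', hle'⟩ := h.exists_orbitIdeal_le q
    rwa [h.eq_of_orbitIdeal_le he' he (hle'.trans hle)] at hle'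

lemma ncard_irreducibleComponents (h : IsTorusCurve I g n u X) :
    (irreducibleComponents (PrimeSpectrum (MvPolynomial σ ℂ ⧸ I))).ncard = g := by
  rw [← h.ncard_orbitReps, ← Set.InjOn.ncard_image (f := orbitIdeal I n) fun e he e' he' heq =>
      h.eq_of_orbitIdeal_le he he' heq.le, ← h.minimalPrimes_eq,
    ← PrimeSpectrum.vanishingIdeal_irreducibleComponents, Set.InjOn.ncard_image]
  intro Z hZ Z' hZ' heq
  rw [← (isClosed_of_mem_irreducibleComponents Z hZ).closure_eq,
    ← (isClosed_of_mem_irreducibleComponents Z' hZ').closure_eq,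
    ← PrimeSpectrum.zeroLocus_vanishingIdeal_eq_closure,
    ← PrimeSpectrum.zeroLocus_vanishingIdeal_eq_closure, heq]

lemma exists_vanishingIdeal_eq (h : IsTorusCurve I g n u X)
    {Z : Set (PrimeSpectrum (MvPolynomial σ ℂ ⧸ I))} (hZ : Z ∈ irreducibleComponents _) :
    ∃ e ∈ orbitReps u X, PrimeSpectrum.vanishingIdeal Z = orbitIdeal I n e := by
  have h1 := h.minimalPrimes_eq ▸ PrimeSpectrum.vanishingIdeal_irreducibleComponents
    (R := MvPolynomial σ ℂ ⧸ I)
  obtain ⟨e, he, heq⟩ := (h1 ▸ Set.mem_image_of_mem _ hZ :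
    PrimeSpectrum.vanishingIdeal Z ∈ orbitIdeal I n '' orbitReps u X)
  exact ⟨e, he, heq.symm⟩

end Parametrization

end IsTorusCurve

/-! ### Krull dimension and regular parameters. -/

section Dimension

lemma ringKrullDim_le_of_isIntegral (R S : Type*) [CommRing R] [CommRing S] [Algebra R S]
    [Algebra.IsIntegral R S] : ringKrullDim S ≤ ringKrullDim R := by
  refine Order.krullDim_le_of_strictMono (PrimeSpectrum.comap (algebraMap R S)) fun p q hpq => ?_
  have := p.isPrime
  exact Ideal.IsIntegral.comap_lt_comap (show p.asIdeal < q.asIdeal from hpq)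

lemma one_le_ringKrullDim {A : Type*} [CommRing A] [IsDomain A] {x : A} (hx : x ≠ 0)
    (hu : ¬ IsUnit x) : 1 ≤ ringKrullDim A := by
  have h1 := ringKrullDim_quotient_succ_le_of_nonZeroDivisor (mem_nonZeroDivisors_of_ne_zero hx)
  have : Nontrivial (A ⧸ Ideal.span {x}) := Ideal.Quotient.nontrivial_iff.2 fun h =>
    hu (Ideal.span_singleton_eq_top.1 h)
  refine le_trans ?_ h1
  have h2 := ringKrullDim_nonneg_of_nontrivial (R := A ⧸ Ideal.span {x})
  calc (1 : WithBot ℕ∞) = 0 + 1 := (zero_add 1).symm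
    _ ≤ _ := by gcongr

open IsLocalRing in
/-- The quotient of a regular local ring by a regular parameter is regular. -/
lemma IsRegularLocalRing.quotient_span_singleton {R : Type*} [CommRing R] [IsRegularLocalRing R]
    {f : R} (hf : f ∈ maximalIdeal R) (hf2 : f ∉ maximalIdeal R ^ 2) :
    IsRegularLocalRing (R ⧸ Ideal.span {f}) := by
  classical
  have hnt : Nontrivial (R ⧸ Ideal.span {f}) := Ideal.Quotient.nontrivial_iff.2 fun h =>
    (mem_maximalIdeal f).1 hf (Ideal.span_singleton_eq_top.1 h)
  have : IsLocalRing (R ⧸ Ideal.span {f}) :=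
    .of_surjective' (Ideal.Quotient.mk _) Ideal.Quotient.mk_surjective
  set k := ResidueField R
  set F : maximalIdeal R := ⟨f, hf⟩ with hF
  set v : CotangentSpace R := (maximalIdeal R).toCotangent F with hv
  have hv0 : v ≠ 0 := fun h => hf2 (((maximalIdeal R).toCotangent_eq_zero F).1 h)
  -- The class of `f` is extended to a basis of the cotangent space. By Nakayama, lifts of the basis
  -- generate the maximal ideal, and killing `f` saves one generator.
  have hli : LinearIndepOn k id {v} := LinearIndepOn.singleton hv0
  set T := hli.extend (Set.subset_univ _) with hT
  have hvT : v ∈ T := hli.subset_extend _ rfl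
  have hTspan : Submodule.span k T = ⊤ := by
    rw [hT, ← Module.Basis.range_extend hli, Module.Basis.span_eq]
  have hTfin : T.Finite := by
    have := Module.Finite.finite_basis (Module.Basis.extend hli)
    exact Set.toFinite T
  have hTcard : T.ncard = (maximalIdeal R).spanFinrank := by
    rw [spanFinrank_maximalIdeal_eq_finrank_cotangentSpace,
      Module.finrank_eq_nat_card_basis (Module.Basis.extend hli), Nat.card_coe_set_eq]
  obtain ⟨s, hs⟩ := ((maximalIdeal R).toCotangent_surjective).hasRightInverse
  have hgen : Submodule.span R (insert F (s '' (T \ {v}))) = ⊤ := by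
    rw [← CotangentSpace.span_image_eq_top_iff, Set.image_insert_eq, Set.image_image]
    simp only [hs _, Set.image_id', ← hv]
    rw [Set.insert_sdiff_singleton, Set.insert_eq_of_mem hvT]
    exact hTspan
  have hgen' : Ideal.span (insert f ((fun x => ((s x : maximalIdeal R) : R)) '' (T \ {v}))) =
      maximalIdeal R := by
    have h1 := congrArg (Submodule.map (maximalIdeal R).subtype) hgen
    rw [Submodule.map_span, Submodule.map_top, Submodule.range_subtype, Set.image_insert_eq,
      Set.image_image] at h1
    exact h1
  have hmax : maximalIdeal (R ⧸ Ideal.span {f}) = Ideal.span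
      ((fun x => Ideal.Quotient.mk (Ideal.span {f}) (s x)) '' (T \ {v})) := by
    have : IsLocalHom (Ideal.Quotient.mk (Ideal.span {f})) :=
      IsLocalHom.of_surjective _ Ideal.Quotient.mk_surjective
    refine (map_maximalIdeal_of_surjective (Ideal.Quotient.mk (Ideal.span {f}))
      Ideal.Quotient.mk_surjective).symm.trans
      ((congrArg (Ideal.map (Ideal.Quotient.mk (Ideal.span {f}))) hgen').symm.trans ?_)
    rw [Ideal.map_span, Set.image_insert_eq, Set.image_image,
      Ideal.Quotient.eq_zero_iff_mem.2 (Ideal.mem_span_singleton_self f), Ideal.span_insert_zero]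
  have hle : (maximalIdeal (R ⧸ Ideal.span {f})).spanFinrank + 1 ≤
      (maximalIdeal R).spanFinrank := by
    rw [← hTcard, ← Set.ncard_sdiff_singleton_add_one hvT hTfin, hmax]
    have hfin : (T \ {v}).Finite := hTfin.subset Set.sdiff_subset
    have := (Submodule.spanFinrank_span_le_ncard_of_finite (R := R ⧸ Ideal.span {f})
      (hfin.image fun x => Ideal.Quotient.mk (Ideal.span {f}) (s x))).trans
      (Set.ncard_image_le hfin)
    exact Nat.add_le_add_right this 1
  refine .of_spanFinrank_maximalIdeal_le _ ?_
  -- The dimension falls by at most one, so it still bounds the number of generators.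
  have h1 : ringKrullDim R ≤ ringKrullDim (R ⧸ Ideal.span {f}) + 1 := by
    have := ringKrullDim_le_ringKrullDim_quotient_add_card (R := R) {f} (by
      rw [IsLocalRing.ringJacobson_eq_maximalIdeal]; simpa using hf)
    rw [Finset.coe_singleton, Finset.card_singleton] at this
    exact_mod_cast this
  rw [← (isRegularLocalRing_iff R).1 ‹_›] at h1
  have h2 : (((maximalIdeal (R ⧸ Ideal.span {f})).spanFinrank : WithBot ℕ∞) + 1) ≤
      ringKrullDim (R ⧸ Ideal.span {f}) + 1 := by
    refine le_trans ?_ h1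
    exact_mod_cast hle
  exact ENat.WithBot.add_le_add_one_right_iff.1 h2

end Dimension

/-! ### Local rings at points of an affine scheme. -/

section LocalRing

variable {σ : Type*} {I : Ideal (MvPolynomial σ ℂ)} {p : σ → ℂ}

lemma mem_vanishingIdeal_point {f : MvPolynomial σ ℂ} :
    f ∈ (vanishingIdeal ℂ {p} : Ideal (MvPolynomial σ ℂ)) ↔ eval p f = 0 :=
  mem_vanishingIdeal_singleton_iff p f

lemma vanishingIdeal_point_eq_span : (vanishingIdeal ℂ {p} : Ideal (MvPolynomial σ ℂ)) =
    Ideal.span (Set.range fun w => X w - C (p w)) := by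
  apply le_antisymm
  · intro f hf
    set J := Ideal.span (Set.range fun w => (X w - C (p w) : MvPolynomial σ ℂ))
    -- Modulo the z_w - p_w every polynomial equals its value at `p`.
    have h1 : (Ideal.Quotient.mkₐ ℂ J) =
        ((Algebra.ofId ℂ (MvPolynomial σ ℂ ⧸ J)).comp (aeval p)) := by
      ext w
      simp only [Ideal.Quotient.mkₐ_eq_mk, AlgHom.comp_apply, aeval_X]
      exact Ideal.Quotient.eq.2 (Ideal.subset_span ⟨w, rfl⟩)
    have h2 := DFunLike.congr_fun h1 f
    rw [AlgHom.comp_apply, show aeval p f = 0 from mem_vanishingIdeal_point.1 hf, map_zero] at h2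
    exact Ideal.Quotient.eq_zero_iff_mem.1 h2
  · rw [Ideal.span_le]
    rintro _ ⟨w, rfl⟩
    exact mem_vanishingIdeal_point.2 (by simp)

variable (I p) in
/-- The germ at `p` of a polynomial, as a function on the subscheme defined by `I`. -/
def germ : MvPolynomial σ ℂ →+* LocalRingAt I p :=
  (Ideal.Quotient.mk _).comp (algebraMap _ _)

lemma isUnit_germ {f : MvPolynomial σ ℂ} (hf : eval p f ≠ 0) : IsUnit (germ I p f) :=
  (IsLocalization.map_units (Localization.AtPrime (vanishingIdeal ℂ {p} :
    Ideal (MvPolynomial σ ℂ))) (⟨f, fun h => hf (mem_vanishingIdeal_point.1 h)⟩ :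
    (vanishingIdeal ℂ {p} : Ideal (MvPolynomial σ ℂ)).primeCompl)).map (Ideal.Quotient.mk _)

lemma germ_eq_zero_of_mem {f : MvPolynomial σ ℂ} (hf : f ∈ I) : germ I p f = 0 :=
  Ideal.Quotient.eq_zero_iff_mem.2 (Ideal.mem_map_of_mem _ hf)

lemma germ_eq_zero {f h : MvPolynomial σ ℂ} (hh : eval p h ≠ 0) (hf : h * f ∈ I) :
    germ I p f = 0 := by
  have h1 := germ_eq_zero_of_mem (p := p) hf
  rw [map_mul] at h1
  exact (isUnit_germ hh).mul_right_eq_zero.1 h1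

lemma nontrivial_localRingAt (hp : p ∈ zeroLocus ℂ I) : Nontrivial (LocalRingAt I p) := by
  refine Ideal.Quotient.nontrivial_iff.2 (ne_top_of_le_ne_top
    (IsLocalRing.maximalIdeal.isMaximal _).ne_top ?_)
  rw [← Localization.AtPrime.map_eq_maximalIdeal]
  exact Ideal.map_mono fun f hf => mem_vanishingIdeal_point.2 (hp f hf)

lemma isLocalRing_localRingAt (hp : p ∈ zeroLocus ℂ I) : IsLocalRing (LocalRingAt I p) := by
  have := nontrivial_localRingAt hp
  exact .of_surjective' (Ideal.Quotient.mk _) Ideal.Quotient.mk_surjective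

lemma IsLocalRing.maximalIdeal_eq_span_of_surjective {R S ι : Type*} [CommRing R] [IsLocalRing R]
    [CommRing S] [IsLocalRing S] (q : R →+* S) (hq : Function.Surjective q) {a : ι → R}
    (ha : maximalIdeal R = Ideal.span (Set.range a)) :
    maximalIdeal S = Ideal.span (Set.range fun i => q (a i)) := by
  have : IsLocalHom q := IsLocalHom.of_surjective _ hq
  rw [← IsLocalRing.map_maximalIdeal_of_surjective q hq, ha, Ideal.map_span, ← Set.range_comp]
  rfl

lemma maximalIdeal_localRingAt [IsLocalRing (LocalRingAt I p)] :
    IsLocalRing.maximalIdeal (LocalRingAt I p) =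
      Ideal.span (Set.range fun w => germ I p (X w - C (p w))) := by
  have h1 : IsLocalRing.maximalIdeal (Localization.AtPrime
      (vanishingIdeal ℂ {p} : Ideal (MvPolynomial σ ℂ))) =
      Ideal.span (Set.range fun w => algebraMap _ _ (X w - C (p w) : MvPolynomial σ ℂ)) := by
    rw [← Localization.AtPrime.map_eq_maximalIdeal]
    refine (congrArg (Ideal.map _) vanishingIdeal_point_eq_span).trans ?_
    rw [Ideal.map_span, ← Set.range_comp]
    rfl
  exact IsLocalRing.maximalIdeal_eq_span_of_surjective (Ideal.Quotient.mk _)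
    Ideal.Quotient.mk_surjective h1

lemma germ_mem_maximalIdeal [IsLocalRing (LocalRingAt I p)] {f : MvPolynomial σ ℂ}
    (hf : eval p f = 0) : germ I p f ∈ IsLocalRing.maximalIdeal (LocalRingAt I p) := by
  rw [maximalIdeal_localRingAt]
  have h1 := mem_vanishingIdeal_point.2 hf
  rw [vanishingIdeal_point_eq_span] at h1
  have h2 := Ideal.mem_map_of_mem (germ I p) h1
  rwa [Ideal.map_span, ← Set.range_comp] at h2

/-- A homomorphism from the polynomial ring to a field that kills `I` and no polynomial that is
nonzero at `p` factors over the local ring at `p`. -/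
lemma exists_lift_germ {K : Type*} [Field K] (ψ : MvPolynomial σ ℂ →+* K) (hI : ∀ f ∈ I, ψ f = 0)
    (hp : ∀ f, eval p f ≠ 0 → ψ f ≠ 0) :
    ∃ φ : LocalRingAt I p →+* K, ∀ f, φ (germ I p f) = ψ f := by
  have hu : ∀ y : (vanishingIdeal ℂ {p} : Ideal (MvPolynomial σ ℂ)).primeCompl,
      IsUnit (ψ y) := fun y => (hp y fun h => y.2 (mem_vanishingIdeal_point.2 h)).isUnit
  let ψ' := IsLocalization.lift (S := Localization.AtPrime (vanishingIdeal ℂ {p} :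
    Ideal (MvPolynomial σ ℂ))) hu
  refine ⟨Ideal.Quotient.lift _ ψ' ?_, fun f => ?_⟩
  · intro a ha
    have h1 : I.map (algebraMap _ _) ≤ RingHom.ker ψ' := by
      rw [Ideal.map_le_iff_le_comap]
      intro f hf
      rw [Ideal.mem_comap, RingHom.mem_ker, IsLocalization.lift_eq, hI f hf]
    exact h1 ha
  · exact IsLocalization.lift_eq hu f

end LocalRing

/-! ### Tangent vectors and the Jacobian criterion for a hypersurface. -/

section TangentSpace

variable {σ : Type*} [Fintype σ]

lemma tangent_mul (p v : σ → ℂ) (f h : MvPolynomial σ ℂ) :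
    ∑ w, eval p (pderiv w (f * h)) * v w =
      eval p f * ∑ w, eval p (pderiv w h) * v w + eval p h * ∑ w, eval p (pderiv w f) * v w := by
  simp only [Finset.mul_sum, ← Finset.sum_add_distrib]
  refine Finset.sum_congr rfl fun w _ => ?_
  rw [Derivation.leibniz]
  simp only [smul_eq_mul, map_add, map_mul]
  ring

lemma tangent_eq_zero_of_mem_sq {p : σ → ℂ} (v : σ → ℂ) {f : MvPolynomial σ ℂ}
    (hf : f ∈ (vanishingIdeal ℂ {p} : Ideal (MvPolynomial σ ℂ)) ^ 2) :
    ∑ w, eval p (pderiv w f) * v w = 0 := by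
  rw [pow_two] at hf
  refine Submodule.mul_induction_on hf (fun a ha b hb => ?_) fun a b ha hb => ?_
  · rw [tangent_mul, mem_vanishingIdeal_point.1 ha, mem_vanishingIdeal_point.1 hb,
      zero_mul, zero_mul, add_zero]
  · simp only [map_add, add_mul, Finset.sum_add_distrib, ha, hb, add_zero]

lemma tangent_eq_zero_of_mem_span {p v : σ → ℂ} {f : MvPolynomial σ ℂ} (hp : eval p f = 0)
    (hv : ∑ w, eval p (pderiv w f) * v w = 0) :
    v ∈ tangentSpaceAt (Ideal.span {f}) p := by
  intro a ha
  obtain ⟨b, rfl⟩ := Ideal.mem_span_singleton.1 ha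
  rw [tangent_mul, hp, hv, zero_mul, mul_zero, add_zero]

/-- A hypersurface is smooth at a point where some directional derivative does not vanish. -/
lemma isSmoothPoint_span_singleton {p v : σ → ℂ} {f : MvPolynomial σ ℂ} (hp : eval p f = 0)
    (hv : ∑ w, eval p (pderiv w f) * v w ≠ 0) : IsSmoothPoint (Ideal.span {f}) p := by
  have h0 : (Ideal.span {f}).map (algebraMap (MvPolynomial σ ℂ) (Localization.AtPrime
      (vanishingIdeal ℂ {p} : Ideal (MvPolynomial σ ℂ)))) = Ideal.span {algebraMap _ _ f} := by
    rw [Ideal.map_span, Set.image_singleton]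
  change IsRegularLocalRing (_ ⧸ _)
  rw [h0]
  refine IsRegularLocalRing.quotient_span_singleton ?_ ?_
  · rw [← Localization.AtPrime.map_eq_maximalIdeal]
    exact Ideal.mem_map_of_mem _ (mem_vanishingIdeal_point.2 hp)
  · rw [← Localization.AtPrime.map_eq_maximalIdeal, ← Ideal.map_pow,
      IsLocalization.algebraMap_mem_map_algebraMap_iff
        (vanishingIdeal ℂ {p} : Ideal (MvPolynomial σ ℂ)).primeCompl]
    -- If `h * f` lay in the square of the ideal of `p`, with `h` nonzero at `p`, the Leibniz rule
    -- would make the derivative of `f` along `v` vanish.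
    rintro ⟨h, hh, hmem⟩
    have h1 := tangent_eq_zero_of_mem_sq v hmem
    rw [tangent_mul, hp, zero_mul, add_zero] at h1
    exact (mul_ne_zero (fun h2 => hh (mem_vanishingIdeal_point.2 h2)) hv) h1

lemma derivative_aeval (φ : σ → Polynomial ℂ) (f : MvPolynomial σ ℂ) :
    Polynomial.derivative (aeval φ f) =
      ∑ w, aeval φ (pderiv w f) * Polynomial.derivative (φ w) := by
  classical
  induction f using MvPolynomial.induction_on with
  | C a => simp
  | add p q hp hq => simp only [map_add, hp, hq, add_mul, Finset.sum_add_distrib]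
  | mul_X p i hp =>
    have h1 : ∑ w, aeval φ p * aeval φ (pderiv w (X i : MvPolynomial σ ℂ)) * Polynomial.derivative (φ w) =
        aeval φ p * Polynomial.derivative (φ i) := by
      rw [Finset.sum_eq_single_of_mem i (Finset.mem_univ i), pderiv_X_self, map_one, mul_one]
      intro w _ hw
      rw [pderiv_X_of_ne hw.symm, map_zero, mul_zero, zero_mul]
    rw [map_mul, Polynomial.derivative_mul, hp, aeval_X, Finset.sum_mul, ← h1,
      ← Finset.sum_add_distrib]
    refine Finset.sum_congr rfl fun w _ => ?_
    rw [Derivation.leibniz, smul_eq_mul, smul_eq_mul, map_add, map_mul, map_mul, aeval_X]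
    ring

end TangentSpace

namespace IsTorusCurve

variable {σ : Type*} [Fintype σ] {I : Ideal (MvPolynomial σ ℂ)} {g : ℕ} {n : σ → ℕ} {u : σ → ℤ}
  {X : Set (σ → ℂˣ)}

/-! ### The curve and its components have dimension one. -/

section Dimension

/-- Finitely many monomials generate the coordinate ring as a module over ℂ[z_w], so it is integral
over a ring of dimension one. -/
lemma ringKrullDim_le_one (h : IsTorusCurve I g n u X) :
    ringKrullDim (MvPolynomial σ ℂ ⧸ I) ≤ 1 := by
  obtain ⟨w⟩ := h.nonempty_index
  obtain ⟨B, -, hB⟩ := h.generated w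
  let a : Polynomial ℂ →ₐ[ℂ] MvPolynomial σ ℂ ⧸ I :=
    Polynomial.aeval (Ideal.Quotient.mk I (MvPolynomial.X w))
  let _ : Algebra (Polynomial ℂ) (MvPolynomial σ ℂ ⧸ I) := a.toRingHom.toAlgebra
  have hfin : Module.Finite (Polynomial ℂ) (MvPolynomial σ ℂ ⧸ I) := by
    classical
    refine ⟨⟨B.image fun b => Ideal.Quotient.mk I (monomial b 1), ?_⟩⟩
    rw [eq_top_iff]
    rintro x -
    obtain ⟨f, rfl⟩ := Ideal.Quotient.mk_surjective x
    obtain ⟨q, hq⟩ := exists_coeff hB f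
    rw [hq, map_sum]
    refine Submodule.sum_mem _ fun b hb => ?_
    have h1 : Ideal.Quotient.mk I (Polynomial.aeval (MvPolynomial.X w) (q b) * monomial b 1) =
        q b • Ideal.Quotient.mk I (monomial b 1) := by
      rw [map_mul, Algebra.smul_def]
      congr 1
      exact (Polynomial.aeval_algHom_apply (Ideal.Quotient.mkₐ ℂ I) (MvPolynomial.X w)
        (q b)).symm
    rw [h1]
    exact Submodule.smul_mem _ _ (Submodule.subset_span (Finset.mem_image_of_mem _ hb))
  refine (ringKrullDim_le_of_isIntegral (Polynomial ℂ) _).trans ?_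
  exact (IsPrincipalIdealRing.ringKrullDim_eq_one (Polynomial ℂ) (Polynomial.not_isField ℂ)).le

/-- For the lower bound: z_w restricts to a nonzero multiple of t^(n_w), which is not zero, and not
a unit because it vanishes at t = 0. -/
lemma ringKrullDim_quotient_orbitIdeal (h : IsTorusCurve I g n u X) {e : σ → ℂˣ} (he : e ∈ X) :
    ringKrullDim ((MvPolynomial σ ℂ ⧸ I) ⧸ orbitIdeal I n e) = 1 := by
  refine le_antisymm ((ringKrullDim_quotient_le _).trans h.ringKrullDim_le_one) ?_
  obtain ⟨w⟩ := h.nonempty_index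
  have := h.isPrime_orbitIdeal he
  have hX : param n e (MvPolynomial.X w) = Polynomial.C (e w : ℂ) * Polynomial.X ^ n w :=
    aeval_X _ w
  refine one_le_ringKrullDim (x := Ideal.Quotient.mk _ (Ideal.Quotient.mk I (MvPolynomial.X w)))
    (fun h0 => ?_) fun hu => ?_
  · rw [Ideal.Quotient.eq_zero_iff_mem, h.mk_mem_orbitIdeal he, hX] at h0
    exact mul_ne_zero (Polynomial.C_ne_zero.2 (Units.ne_zero _))
      (pow_ne_zero _ Polynomial.X_ne_zero) h0
  · obtain ⟨y, hy⟩ := hu.exists_right_inv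
    obtain ⟨y, rfl⟩ := Ideal.Quotient.mk_surjective y
    obtain ⟨f, rfl⟩ := Ideal.Quotient.mk_surjective y
    rw [← map_mul, ← map_mul, ← map_one (Ideal.Quotient.mk _), Ideal.Quotient.eq,
      ← map_one (Ideal.Quotient.mk I), ← map_sub, h.mk_mem_orbitIdeal he, map_sub, map_mul, hX,
      map_one] at hy
    have h1 := congrArg (Polynomial.eval 0) hy
    simp [(h.weight_pos w).ne'] at h1

lemma ringKrullDim_eq_one (h : IsTorusCurve I g n u X) :
    ringKrullDim (MvPolynomial σ ℂ ⧸ I) = 1 := by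
  refine le_antisymm h.ringKrullDim_le_one ?_
  obtain ⟨e, he⟩ := Set.nonempty_of_ncard_ne_zero (h.ncard_orbitReps.trans_ne h.pos.ne')
  exact (h.ringKrullDim_quotient_orbitIdeal he.1).ge.trans (ringKrullDim_quotient_le _)

lemma ringKrullDim_component (h : IsTorusCurve I g n u X)
    {Z : Set (PrimeSpectrum (MvPolynomial σ ℂ ⧸ I))} (hZ : Z ∈ irreducibleComponents _) :
    ringKrullDim ((MvPolynomial σ ℂ ⧸ I) ⧸ PrimeSpectrum.vanishingIdeal Z) = 1 := by
  obtain ⟨e, he, heq⟩ := h.exists_vanishingIdeal_eq hZ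
  rw [heq]
  exact h.ringKrullDim_quotient_orbitIdeal he.1

end Dimension

/-! ### Smoothness away from the origin. -/

section Smooth

/-- For every other orbit choose an equation that does not vanish at the point. The product of these
with the given equation vanishes on all orbits, hence lies in `I`, and the extra factors are units
in the local ring. -/
lemma germ_orbitEquation (h : IsTorusCurve I g n u X) {e : σ → ℂˣ} (he : e ∈ orbitReps u X)
    (t : ℂˣ) (w : σ) :
    germ I (fun w => (weightedScale n t e w : ℂ)) (orbitEquation n u e w) = 0 := by
  classical
  have hex : ∀ e', ∃ k, e' ≠ e →
      eval (fun w => (weightedScale n t e w : ℂ)) (orbitEquation n u e' k) ≠ 0 := by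
    intro e'
    by_cases hne : e' = e
    · exact ⟨w, fun h => (h hne).elim⟩
    · obtain ⟨k, hk⟩ := h.exists_orbitEquation_ne_zero he hne t
      exact ⟨k, fun _ => hk⟩
  choose k hk using hex
  refine germ_eq_zero (h := ∏ e' ∈ h.finite_orbitReps.toFinset.erase e,
    orbitEquation n u e' (k e')) ?_ ?_
  · rw [map_prod]
    exact Finset.prod_ne_zero_iff.2 fun e' he' => hk e' (Finset.ne_of_mem_erase he')
  · have hself : ∀ e' ∈ orbitReps u X, ∀ w, param n e' (orbitEquation n u e' w) = 0 :=
      fun e' he' w => (param_eq_zero_iff _ _).2 fun t => h.eval_orbitEquation he' t w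
    refine h.mem_iff_param.2 fun e' he' => ?_
    rw [map_mul, map_prod, mul_eq_zero]
    by_cases hne : e' = e
    · rw [hne]
      exact Or.inr (hself e he w)
    · exact Or.inl (Finset.prod_eq_zero (Finset.mem_erase.2 ⟨hne, by simpa using he'⟩)
        (hself e' he' _))

/-- The maximal ideal of the local ring at a point of the orbit of `e` is principal. -/
lemma exists_maximalIdeal_le_span_singleton (h : IsTorusCurve I g n u X) {e : σ → ℂˣ}
    (he : e ∈ orbitReps u X) (t : ℂˣ)
    [IsLocalRing (LocalRingAt I fun w => (weightedScale n t e w : ℂ))] :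
    ∃ y, IsLocalRing.maximalIdeal (LocalRingAt I fun w => (weightedScale n t e w : ℂ)) =
      Ideal.span {y} := by
  set p : σ → ℂ := fun w => (weightedScale n t e w : ℂ) with hp
  -- This is the local parameter z^u - t with denominators cleared. By the orbit equation, z_w - p_w
  -- times a unit is e_w times a difference of n_w-th powers, which the parameter divides.
  refine ⟨germ I p (posPart u - C (t : ℂ) * posPart (-u)), le_antisymm ?_ ?_⟩
  · rw [maximalIdeal_localRingAt, Ideal.span_le]
    rintro _ ⟨w, rfl⟩
    rw [SetLike.mem_coe, Ideal.mem_span_singleton]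
    have hb : IsUnit (germ I p (posPart (-u)) ^ n w) :=
      (isUnit_germ (eval_posPart_ne_zero _ _)).pow _
    have h1 := h.germ_orbitEquation he t w
    rw [← hp, orbitEquation, map_sub, map_mul, map_mul, map_pow, map_pow] at h1
    rw [← hb.dvd_mul_right]
    have h2 : germ I p (MvPolynomial.X w - C (p w)) * germ I p (posPart (-u)) ^ n w =
        germ I p (C (e w : ℂ)) * (germ I p (posPart u) ^ n w -
          germ I p (C (t : ℂ) * posPart (-u)) ^ n w) := by
      have h3 : p w = t ^ n w * e w := by
        simp [hp, weightedScale]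
      rw [h3, map_sub, map_mul, C_pow, map_mul, map_pow, map_mul]
      linear_combination h1
    rw [h2, map_sub]
    obtain ⟨y, hy⟩ := sub_dvd_pow_sub_pow (germ I p (posPart u))
      (germ I p (C (t : ℂ) * posPart (-u))) (n w)
    rw [hy]
    exact ⟨germ I p (C (e w : ℂ)) * y, by ring⟩
  · rw [Ideal.span_singleton_le_iff_mem]
    refine germ_mem_maximalIdeal ?_
    rw [map_sub, map_mul, eval_C, eval_posPart u, h.prod_zpow_weightedScale, he.2, mul_one,
      sub_self]

/-- In dimension zero z_w - p_w would be nilpotent, so it would become zero in the function field of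
the orbit closure. Evaluating at parameter 0 then gives p_w = 0. -/
lemma not_krullDimLE_zero_localRingAt (h : IsTorusCurve I g n u X) {e : σ → ℂˣ} (he : e ∈ X)
    (t : ℂˣ) [IsLocalRing (LocalRingAt I fun w => (weightedScale n t e w : ℂ))] :
    ¬ Ring.KrullDimLE 0 (LocalRingAt I fun w => (weightedScale n t e w : ℂ)) := by
  intro h0
  set p : σ → ℂ := fun w => (weightedScale n t e w : ℂ) with hp
  obtain ⟨w⟩ := h.nonempty_index
  obtain ⟨φ, hφ⟩ := exists_lift_germ (I := I) (p := p)
    ((algebraMap (Polynomial ℂ) (FractionRing (Polynomial ℂ))).comp (param n e : _ →+* _))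
    (fun f hf => by
      rw [RingHom.comp_apply, RingHom.coe_coe, h.param_eq_zero_of_mem he hf, map_zero])
    (fun f hf h1 => hf (by
      rw [RingHom.comp_apply, RingHom.coe_coe, FaithfulSMul.algebraMap_eq_zero_iff] at h1
      rw [hp, ← eval_param_unit, h1, Polynomial.eval_zero]))
  have h1 : IsNilpotent (germ I p (MvPolynomial.X w - C (p w))) :=
    Ring.KrullDimLE.isNilpotent_iff_mem_maximalIdeal.2 (germ_mem_maximalIdeal (by simp))
  have h2 := (h1.map φ).eq_zero
  rw [hφ, RingHom.comp_apply, RingHom.coe_coe, FaithfulSMul.algebraMap_eq_zero_iff] at h2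
  have h3 := congrArg (Polynomial.eval 0) h2
  rw [eval_param, Polynomial.eval_zero, map_sub, eval_X, eval_C, zero_pow (h.weight_pos w).ne',
    mul_zero, zero_sub, neg_eq_zero] at h3
  exact Units.ne_zero _ h3

lemma isSmoothPoint (h : IsTorusCurve I g n u X) {z : σ → ℂˣ} (hz : z ∈ X) :
    IsSmoothPoint I (fun w => (z w : ℂ)) ∧
      ringKrullDim (LocalRingAt I fun w => (z w : ℂ)) = 1 := by
  have := isLocalRing_localRingAt (h.mem_zeroLocus z hz)
  obtain ⟨e, he, t, rfl⟩ := h.exists_orbitRep hz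
  set R := LocalRingAt I fun w => (weightedScale n t e w : ℂ)
  have hrank : (IsLocalRing.maximalIdeal R).spanFinrank ≤ 1 := by
    obtain ⟨y, hy⟩ := h.exists_maximalIdeal_le_span_singleton he t
    rw [hy]
    exact (Submodule.spanFinrank_span_le_ncard_of_finite (Set.finite_singleton y)).trans
      (Set.ncard_singleton y).le
  have hdim : 1 ≤ ringKrullDim R := by
    by_contra hlt
    refine h.not_krullDimLE_zero_localRingAt he.1 t ?_
    rw [not_le] at hlt
    rw [Ring.krullDimLE_iff]
    exact ENat.WithBot.lt_add_one_iff.1 (by simpa using hlt)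
  have hrank' : ((IsLocalRing.maximalIdeal R).spanFinrank : WithBot ℕ∞) ≤ 1 := by
    exact_mod_cast hrank
  have hreg : IsRegularLocalRing R := .of_spanFinrank_maximalIdeal_le _ (hrank'.trans hdim)
  exact ⟨hreg, le_antisymm (((isRegularLocalRing_iff R).1 hreg).ge.trans hrank') hdim⟩

end Smooth

/-! ### Intersections with the hypersurfaces ∏ z_w^(α_w) = b. -/

section Transversality

/-- The derivative of a polynomial along the orbit of `e`. -/
lemma sum_pderiv_weightedScale (n : σ → ℕ) (e : σ → ℂˣ) (t : ℂˣ) (f : MvPolynomial σ ℂ) :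
    ∑ w, eval (fun w => (weightedScale n t e w : ℂ)) (pderiv w f) *
      ((e w : ℂ) * (n w * (t : ℂ) ^ (n w - 1))) =
    (Polynomial.derivative (param n e f)).eval (t : ℂ) := by
  rw [param, derivative_aeval, Polynomial.eval_finsetSum]
  refine Finset.sum_congr rfl fun w _ => ?_
  rw [Polynomial.eval_mul, ← eval_param_unit, param, Polynomial.derivative_C_mul_X_pow]
  simp [mul_assoc]

lemma meetTransversallyAt (h : IsTorusCurve I g n u X) {α : σ → ℕ} (hα : α ≠ 0) {b : ℂ}
    {z : σ → ℂˣ} (hz : z ∈ X) (hzb : ∏ w, (z w : ℂ) ^ α w = b) :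
    MeetTransversallyAt I (Ideal.span {(∏ w, MvPolynomial.X w ^ α w) - C b})
      fun w => (z w : ℂ) := by
  obtain ⟨e, he, t, rfl⟩ := h.exists_orbitRep hz
  set p : σ → ℂ := fun w => (weightedScale n t e w : ℂ) with hp
  set f : MvPolynomial σ ℂ := (∏ w, MvPolynomial.X w ^ α w) - C b with hf
  -- The velocity of the orbit t ↦ (e_w t^(n_w)), hence a tangent vector of the curve.
  set v : σ → ℂ := fun w => (e w : ℂ) * (n w * (t : ℂ) ^ (n w - 1)) with hv
  have hfp : eval p f = 0 := by
    simp only [hf, map_sub, map_prod, map_pow, eval_X, eval_C]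
    rw [← hzb, sub_self]
  set N := ∑ w, n w * α w with hN
  have hNpos : 0 < N := by
    obtain ⟨w, hw⟩ := Function.ne_iff.1 hα
    exact Finset.sum_pos' (fun _ _ => Nat.zero_le _)
      ⟨w, Finset.mem_univ w, Nat.mul_pos (h.weight_pos w) (Nat.pos_of_ne_zero hw)⟩
  set c : ℂ := ∏ w, (e w : ℂ) ^ α w with hc
  have hc0 : c ≠ 0 := Finset.prod_ne_zero_iff.2 fun w _ => pow_ne_zero _ (Units.ne_zero _)
  have hpf : param n e f = Polynomial.C c * Polynomial.X ^ N - Polynomial.C b := by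
    simp only [hf, param, map_sub, map_prod, map_pow, aeval_X, aeval_C, mul_pow, ← pow_mul,
      Finset.prod_mul_distrib, Finset.prod_pow_eq_pow_sum, hc, hN]
    rfl
  -- This is the derivative of c t^N - b at a nonzero t.
  have hvf : ∑ w, eval p (pderiv w f) * v w ≠ 0 := by
    rw [hp, hv, sum_pderiv_weightedScale, hpf]
    rw [Polynomial.derivative_sub, Polynomial.derivative_C_mul_X_pow]
    simp [hc0, hNpos.ne']
  refine ⟨(h.isSmoothPoint hz).1, isSmoothPoint_span_singleton hfp hvf, ?_⟩
  have hvI : v ∈ tangentSpaceAt I p := by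
    intro a ha
    rw [hp, hv, sum_pderiv_weightedScale, h.param_eq_zero_of_mem he.1 ha]
    simp
  rw [eq_top_iff]
  rintro x -
  set L := fun x : σ → ℂ => ∑ w, eval p (pderiv w f) * x w with hL
  -- Subtracting the right multiple of the velocity leaves a vector in the kernel of the
  -- differential of `f`.
  rw [← add_sub_cancel ((L x / L v) • v) x]
  refine Submodule.add_mem_sup (Submodule.smul_mem _ _ hvI)
    (tangent_eq_zero_of_mem_span hfp ?_)
  have h1 : ∀ w, eval p (pderiv w f) * (x - (L x / L v) • v) w =
      eval p (pderiv w f) * x w - L x / L v * (eval p (pderiv w f) * v w) := by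
    intro w
    simp only [Pi.sub_apply, Pi.smul_apply, smul_eq_mul]
    ring
  simp only [h1, Finset.sum_sub_distrib, ← Finset.mul_sum]
  exact sub_eq_zero.2 (div_mul_cancel₀ (L x) hvf).symm

lemma ncard_prod_pow (h : IsTorusCurve I g n u X) {α : σ → ℕ} (hα : α ≠ 0) {b : ℂ}
    (hb : b ≠ 0) : {z ∈ zeroLocus ℂ I | (∏ w, z w ^ α w) = b}.ncard =
      ∑ w, α w * (g * n w) := by
  have hNpos : 0 < ∑ w, α w * (g * n w) := by
    obtain ⟨w, hw⟩ := Function.ne_iff.1 hα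
    exact Finset.sum_pos' (fun _ _ => Nat.zero_le _) ⟨w, Finset.mem_univ w,
      Nat.mul_pos (Nat.pos_of_ne_zero hw) (Nat.mul_pos h.pos (h.weight_pos w))⟩
  rw [← h.ncard_prod_zpow (α := fun w => α w) hNpos (by push_cast; rfl) (Units.mk0 b hb)]
  have hinj : Function.Injective fun (z : σ → ℂˣ) w => (z w : ℂ) :=
    fun z z' hzz => funext fun w => Units.ext (congrFun hzz w)
  rw [← Set.ncard_image_of_injective _ hinj]
  congr 1
  ext z
  constructor
  · rintro ⟨hz, hzb⟩
    have hz0 : z ≠ 0 := by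
      rintro rfl
      obtain ⟨w, hw⟩ := Function.ne_iff.1 hα
      exact hb (hzb ▸ Finset.prod_eq_zero (Finset.mem_univ w) (zero_pow hw))
    obtain ⟨x, hx, rfl⟩ := h.exists_of_ne_zero z hz hz0
    exact ⟨x, ⟨hx, Units.ext (by simpa using hzb)⟩, rfl⟩
  · rintro ⟨x, ⟨hx, hxb⟩, rfl⟩
    exact ⟨h.mem_zeroLocus x hx, by simpa using congrArg Units.val hxb⟩

end Transversality

end IsTorusCurve

/-! ### Splice diagram curves satisfy `IsTorusCurve`. -/

namespace RootedSpliceDiagram.CurveData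

variable {V : Type*} [Fintype V] {D : RootedSpliceDiagram V} (C : D.CurveData)

lemma isTorusCurve {r : D.OutEdge D.root} (hr : ∀ e, e = r)
    (hb : ∀ x, x ≠ D.root → D.Below r.1 x) {g : ℕ} (hg : 0 < g) {n : D.Var → ℕ}
    (hn : ∀ w, 0 < n w) (hl : ∀ w : D.Var, D.linking D.root w.1 = g * n w) {u : D.Var → ℤ}
    (hu : ∑ w, u w * n w = 1) : IsTorusCurve C.ideal g n u (C.torusPoints r.1) where
  pos := hg
  weight_pos := hn
  bezout := hu
  mem_zeroLocus z hz := by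
    rw [C.mem_zeroLocus_iff]
    intro v
    obtain ⟨s, hs⟩ := hz.2 v (hb _ v.ne_root)
    exact ⟨s, fun e => by simpa using congrArg Units.val (hs e)⟩
  exists_of_ne_zero z hz h0 := by
    have hne : ∀ w, z w ≠ 0 := fun w hw => h0 (funext (C.eq_zero_of_mem_zeroLocus hz hw))
    refine ⟨fun w => Units.mk0 (z w) (hne w), ⟨fun w hw => (hw (hb _ w.2.2)).elim,
      fun v _ => ?_⟩, rfl⟩
    obtain ⟨s, hs⟩ := (C.mem_zeroLocus_iff z).1 hz v
    obtain ⟨e⟩ := Node.nonempty_outEdge D v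
    have hs0 : s ≠ 0 := by
      rintro rfl
      have h1 := hs e
      rw [mul_zero] at h1
      exact Finset.prod_ne_zero_iff.2 (fun w _ => pow_ne_zero _ (hne w)) h1
    exact ⟨Units.mk0 s hs0, fun e => Units.ext (by simpa using hs e)⟩
  scale_mem t z hz := by
    -- The known action has weights ℓ = g n; a g-th root of t turns it into the action with weights
    -- n.
    obtain ⟨s, rfl⟩ := exists_unit_pow_eq hg t
    have h1 := C.weightedScale_mem_torusPoints s hz
    have h2 : weightedScale (D.linkingBelow r.1) s z = weightedScale n (s ^ g) z := by
      ext w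
      simp [weightedScale, linkingBelow_top hr, hl, pow_mul]
    rwa [h2] at h1
  ncard_fiber w b := by
    rw [C.ncard_torusPoints r.1 r.ne_root w (hb _ w.2.2), linkingBelow_top hr, hl]
  generated w := by
    obtain ⟨B, hB, -, h1⟩ := C.generatedBy_single r.1 r.ne_root w (hb _ w.2.2)
    refine ⟨B, hB.trans_eq (by rw [linkingBelow_top hr, hl]), fun m => ?_⟩
    obtain ⟨i, b, hb', -, c, hc⟩ := h1 m fun w _ => hb _ w.2.2
    exact ⟨i, b, hb', c, hc⟩

lemma exists_isTorusCurve : ∃ n u X,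
    IsTorusCurve C.ideal (Finset.univ.gcd fun w : D.Var => D.linking D.root w.1) n u X ∧
      ∀ w : D.Var, D.linking D.root w.1 =
        Finset.univ.gcd (fun w : D.Var => D.linking D.root w.1) * n w := by
  obtain ⟨r, hr, hb⟩ := D.exists_top
  have := D.nonempty_var
  obtain ⟨hg, n, hn, hl, u, hu⟩ := exists_coprime_weights
    (l := fun w : D.Var => D.linking D.root w.1) linking_root_pos
  exact ⟨n, u, _, C.isTorusCurve hr hb hg hn hl hu, hl⟩

end RootedSpliceDiagram.CurveData

end

theorem mainTheorem4 {V : Type*} [Fintype V] (D : RootedSpliceDiagram V) (C : D.CurveData) :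
    -- a point with one vanishing coordinate is the origin
    (∀ z ∈ MvPolynomial.zeroLocus ℂ C.ideal, (∃ w, z w = 0) → ∀ w, z w = 0) ∧
    -- away from the origin, `C` is a smooth curve
    (∀ z ∈ MvPolynomial.zeroLocus ℂ C.ideal, z ≠ 0 →
      IsSmoothPoint C.ideal z ∧ ringKrullDim (LocalRingAt C.ideal z) = 1) ∧
    -- the number of components
    (irreducibleComponents (PrimeSpectrum C.coordRing)).ncard =
      Finset.univ.gcd (fun w : D.Var => D.linking D.root w.1) ∧
    -- reduced complete intersection curve, with monomial curves as components
    (IsReduced C.coordRing ∧ IsCompleteIntersectionCurve C.equation ∧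
      ∀ Z ∈ irreducibleComponents (PrimeSpectrum C.coordRing),
        IsMonomialCurveRing (C.coordRing ⧸ PrimeSpectrum.vanishingIdeal Z)) ∧
    -- intersections with `∏ z_w ^ α_w = b`
    (∀ α : D.Var → ℕ, α ≠ 0 → ∀ b : ℂ, b ≠ 0 →
      (∀ z ∈ MvPolynomial.zeroLocus ℂ C.ideal, (∏ w, z w ^ α w) = b →
        MeetTransversallyAt C.ideal
          (Ideal.span {(∏ w, MvPolynomial.X w ^ α w) - MvPolynomial.C b}) z) ∧
      {z ∈ MvPolynomial.zeroLocus ℂ C.ideal | (∏ w, z w ^ α w) = b}.ncard =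
        ∑ w, α w * D.linking D.root w.1) := by
  obtain ⟨n, u, X, h, hl⟩ := C.exists_isTorusCurve
  refine ⟨fun z hz ⟨w, hw⟩ => C.eq_zero_of_mem_zeroLocus hz hw, fun z hz h0 => ?_,
    h.ncard_irreducibleComponents,
    ⟨h.isReduced, ⟨D.card_equations_add_one, h.ringKrullDim_eq_one,
      fun Z hZ => h.ringKrullDim_component hZ⟩, fun Z hZ => ?_⟩, fun α hα b hb => ⟨fun z hz hzb => ?_, ?_⟩⟩
  · obtain ⟨x, hx, rfl⟩ := h.exists_of_ne_zero z hz h0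
    exact h.isSmoothPoint hx
  · obtain ⟨e, he, heq⟩ := h.exists_vanishingIdeal_eq hZ
    rw [heq]
    exact h.isMonomialCurveRing he.1
  · have h0 : z ≠ 0 := by
      rintro rfl
      obtain ⟨w, hw⟩ := Function.ne_iff.1 hα
      exact hb (hzb ▸ Finset.prod_eq_zero (Finset.mem_univ w) (zero_pow hw))
    obtain ⟨x, hx, rfl⟩ := h.exists_of_ne_zero z hz h0
    exact h.meetTransversallyAt hα hx hzb
  · rw [h.ncard_prod_pow hα hb]
    exact Finset.sum_congr rfl fun w _ => by rw [← hl]
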